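/- **Setting.** Let $q\ge 2$, $n\ge 1$, $d=q^n$, and consider $n$ qudits of local dimension $q$ on a line, followed by one ancilla qubit. Let $\mathsf G\subset U(q^2)$ be a finite gate set containing the identity; its elements act on neighbouring qudits $i,i+1$. The bond between the last qudit and the ancilla qubit carries gates from a finite set $\mathsf A\subset U(2q)$ that contains the identity and satisfies $|\mathsf A|\le|\mathsf G|$ (for qubits, $q=2$, one takes $\mathsf A=\mathsf G$). Let $\mathsf G_r\subset U(2d)$ be the set of products of at most $r$ such gates, and let $$\mathsf M_r=\bigl\{\mathrm{Tr}_2\bigl((\mathbb I\otimes|0\rangle\langle 0|)\,VP_lV^\dagger\bigr): V\in\mathsf G_r,\ 1\le l\le 2d\bigr\},$$ where $P_l$ projects onto the first $l$ computational basis vectors in lexicographic order and $\mathrm{Tr}_2$ traces out the ancilla. For $\delta\in(0,1)$, the strong $\delta$-state complexity $\mathcal C_\delta(|\psi\rangle)$ of a pure state is the least $r\in\mathbb N$ with $$\max_{M\in\mathsf M_r}\bigl|\mathrm{Tr}\bigl(M(|\psi\rangle\langle\psi|-\mathbb I/d)\bigr)\bigr|\ \ge\ 1-\tfrac1d-\delta$$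 (and $\infty$ if there is none). A finite ensemble $\{p_i,U_i\}_{i=1}^N$ of unitaries in $U(d)$ is an $\epsilon$-approximate $t$-design if $$\Bigl\|\sum_i p_i\,U_i^{\otimes t}(\cdot)(U_i^{\dagger})^{\otimes t}-\int_{U(d)}U^{\otimes t}(\cdot)(U^{\dagger})^{\otimes t}\,dU\Bigr\|_\diamond\le\frac{t!}{d^{2t}}\,\epsilon ,$$ with the Haar probability measure and the diamond norm $\|\Phi\|_\diamond=\sup_{\|X\|_1\le1}\|(\Phi\otimes\mathrm{id})(X)\|_1$. **Theorem (state complexity growth).** (a) Let $k\ge1$, $r\ge0$, $\epsilon>0$, $\delta\in(0,1)$, let $\{p_i,U_i\}$ be an $\epsilon$-approximate $2k$-design in $d=q^n$ dimensions, and let $|\psi_0\rangle$ be a fixed pure state. Then the set of pure states $\{U_i|\psi_0\rangle\langle\psi_0|U_i^\dagger\}_i$ contains at least $$L:=\binom{d+k-1}{k}\left(\frac1{1+\epsilon}-2\,d\,n^r|\mathsf G|^r\Bigl(\frac{16k^2}{d(1-\delta)^2}\Bigr)^{k}\right)$$ distinct elements (states being identified when they differ by a global phase) with $\mathcal C_\delta\ge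 r+1$. (b) The number $L$ is of order $(d/k)^k$ as long as $r\lesssim k(n-2\log k)/\log n$, in the following sense. There are absolute constants $c,C>0$ and, for every $\epsilon>0$ and $\delta\in(0,1)$, a threshold $T=T(\epsilon,\delta)$ such that for all $q\ge2$, $k\ge2$, $n$ and $|\mathsf G|$ with $1\le|\mathsf G|\le n$ and $n-2\log_q k\ge T$, and all integers $r\ge 0$ with $$r\le c\,\frac{k\,(n-2\log_q k)}{\log_q n},$$ one has $$\frac{1}{2(1+\epsilon)}\Bigl(\frac dk\Bigr)^k\ \le\ L\ \le\ \Bigl(\frac{C\,d}{k}\Bigr)^k .$$ -/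

import Mathlib

open MeasureTheory Matrix
open scoped Kronecker ENNReal

namespace DesignComplexity

/-! ### Unitary groups and Haar measure -/

instance compactSpace_unitaryGroup {α : Type*} [Fintype α] [DecidableEq α] :
    CompactSpace (Matrix.unitaryGroup α ℂ) := by
  suffices h : IsCompact
      ((Matrix.unitaryGroup α ℂ : Submonoid (Matrix α α ℂ)) : Set (Matrix α α ℂ)) from
    isCompact_iff_compactSpace.mp h
  have hK : IsCompact (Set.pi Set.univ fun _ : α =>
      Set.pi Set.univ fun _ : α => Metric.closedBall (0 : ℂ) 1) :=
    isCompact_univ_pi fun _ => isCompact_univ_pi fun _ => isCompact_closedBall 0 1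
  refine IsCompact.of_isClosed_subset (s := (Set.pi Set.univ fun _ : α =>
      Set.pi Set.univ fun _ : α => Metric.closedBall (0 : ℂ) 1)) hK ?_ ?_
  · have : ((Matrix.unitaryGroup α ℂ : Submonoid (Matrix α α ℂ)) : Set (Matrix α α ℂ))
        = {A : Matrix α α ℂ | A * star A = 1} := by
      ext A
      exact Matrix.mem_unitaryGroup_iff
    rw [this]
    exact isClosed_eq (by fun_prop) continuous_const
  · intro A hA i _ j _
    simpa using entry_norm_bound_of_unitary hA i j

noncomputable instance measurableSpace_unitaryGroup {α : Type*} [Fintype α] [DecidableEq α] :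
    MeasurableSpace (Matrix.unitaryGroup α ℂ) :=
  borel _

instance borelSpace_unitaryGroup {α : Type*} [Fintype α] [DecidableEq α] :
    BorelSpace (Matrix.unitaryGroup α ℂ) :=
  ⟨rfl⟩

/-- The Haar probability measure on the unitary group. -/
noncomputable def haarUnitary (α : Type*) [Fintype α] [DecidableEq α] :
    Measure (Matrix.unitaryGroup α ℂ) :=
  Measure.haarMeasure ⊤

/-! ### Twirling channels -/

/-- The tensor power `A^{⊗ t}` as a matrix acting on `(ℂ^α)^{⊗ t}`. -/
def tensorPower {α : Type*} (t : ℕ) (A : Matrix α α ℂ) :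
    Matrix (Fin t → α) (Fin t → α) ℂ :=
  Matrix.of fun a b => ∏ i, A (a i) (b i)

/-- `U^{⊗ t} X (U^{⊗ t})†`. -/
noncomputable def tensorConj {α : Type*} [Fintype α] [DecidableEq α] (t : ℕ) (U : Matrix.unitaryGroup α ℂ) :
    Matrix (Fin t → α) (Fin t → α) ℂ →ₗ[ℂ] Matrix (Fin t → α) (Fin t → α) ℂ where
  toFun X := tensorPower t U.1 * X * (tensorPower t U.1)ᴴ
  map_add' X Y := by rw [mul_add, add_mul]
  map_smul' c X := by simp

theorem integrable_tensorConj {α : Type*} [Fintype α] [DecidableEq α] (t : ℕ)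
    (X : Matrix (Fin t → α) (Fin t → α) ℂ) (a b : Fin t → α) :
    Integrable (fun U : Matrix.unitaryGroup α ℂ => tensorConj t U X a b) (haarUnitary α) := by
  have : IsFiniteMeasureOnCompacts (haarUnitary α) := by
    unfold haarUnitary; infer_instance
  have hent : ∀ i j : α, Continuous fun U : Matrix.unitaryGroup α ℂ => U.1 i j := fun i j =>
    (continuous_apply j).comp ((continuous_apply i).comp continuous_subtype_val)
  refine Continuous.integrable_of_hasCompactSupport ?_ (HasCompactSupport.of_compactSpace _)
  simp only [tensorConj, LinearMap.coe_mk, AddHom.coe_mk, Matrix.mul_apply,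
    Matrix.conjTranspose_apply, tensorPower, Matrix.of_apply]
  refine continuous_finsetSum _ fun c _ => Continuous.mul ?_ ?_
  · exact continuous_finsetSum _ fun e _ =>
      (continuous_finsetProd _ fun i _ => hent _ _).mul continuous_const
  · exact continuous_star.comp (continuous_finsetProd _ fun i _ => hent _ _)

/-- The `t`-fold Haar twirl `X ↦ ∫ U^{⊗ t} X (U^{⊗ t})† dU` (entrywise integral). -/
noncomputable def haarTwirl (α : Type*) [Fintype α] [DecidableEq α] (t : ℕ) :
    Matrix (Fin t → α) (Fin t → α) ℂ →ₗ[ℂ] Matrix (Fin t → α) (Fin t → α) ℂ where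
  toFun X := Matrix.of fun a b => ∫ U, tensorConj t U X a b ∂(haarUnitary α)
  map_add' X Y := by
    ext a b
    simp only [map_add, Matrix.add_apply, Matrix.of_apply]
    exact integral_add (integrable_tensorConj t X a b) (integrable_tensorConj t Y a b)
  map_smul' c X := by
    ext a b
    simp only [map_smul, Matrix.smul_apply, Matrix.of_apply, RingHom.id_apply]
    exact integral_smul c _

/-- A finite ensemble `{p_i, U_i}_{i=1}^N` of unitaries: `U_i` occurs with probability `p_i`. -/
structure UnitaryEnsemble (α : Type*) [Fintype α] [DecidableEq α] where
  N : ℕ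
  weight : Fin N → ℝ
  weight_nonneg : ∀ i, 0 ≤ weight i
  weight_sum : ∑ i, weight i = 1
  unitary : Fin N → Matrix.unitaryGroup α ℂ

/-- The `t`-fold twirl `X ↦ ∑ i, p_i U_i^{⊗ t} X (U_i^{⊗ t})†` over an ensemble. -/
noncomputable def UnitaryEnsemble.twirl {α : Type*} [Fintype α] [DecidableEq α]
    (E : UnitaryEnsemble α) (t : ℕ) :
    Matrix (Fin t → α) (Fin t → α) ℂ →ₗ[ℂ] Matrix (Fin t → α) (Fin t → α) ℂ :=
  ∑ i, (E.weight i : ℂ) • tensorConj t (E.unitary i)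

/-! ### Trace norm and diamond norm -/

/-- The trace norm `Tr |X|`: the sum of the singular values of `X`. -/
noncomputable def traceNorm {α : Type*} [Fintype α] [DecidableEq α] (X : Matrix α α ℂ) : ℝ :=
  ∑ i, √((Matrix.isHermitian_conjTranspose_mul_self X).eigenvalues i)

/-- `Φ ⊗ id`, where the identity acts on matrices indexed by `γ`. -/
def ampliation {α β : Type*} (γ : Type*) (Φ : Matrix α α ℂ →ₗ[ℂ] Matrix β β ℂ)
    (X : Matrix (α × γ) (α × γ) ℂ) : Matrix (β × γ) (β × γ) ℂ :=
  Matrix.of fun x y => Φ (Matrix.of fun a b => X (a, x.2) (b, y.2)) x.1 y.1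

/-- The diamond norm `sup {‖(Φ ⊗ id)(X)‖₁ : ‖X‖₁ ≤ 1}`, with a memory of the same dimension as
the input, as an extended nonnegative real. -/
noncomputable def diamondNorm {α β : Type*} [Fintype α] [DecidableEq α] [Fintype β]
    [DecidableEq β] (Φ : Matrix α α ℂ →ₗ[ℂ] Matrix β β ℂ) : ℝ≥0∞ :=
  ⨆ (X : Matrix (α × α) (α × α) ℂ) (_ : traceNorm X ≤ 1),
    ENNReal.ofReal (traceNorm (ampliation α Φ X))

/-- `E` is an `ε`-approximate unitary `t`-design: `‖T_E - T_Haar‖_⋄ ≤ (t! / d^{2t}) ε`. -/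
def UnitaryEnsemble.IsApproxDesign {α : Type*} [Fintype α] [DecidableEq α]
    (E : UnitaryEnsemble α) (ε : ℝ) (t : ℕ) : Prop :=
  diamondNorm (E.twirl t - haarTwirl α t) ≤
    ENNReal.ofReal ((t.factorial : ℝ) / (Fintype.card α : ℝ) ^ (2 * t) * ε)

/-! ### Pure states and orbits -/

/-- The projector `|ψ⟩⟨ψ|`. -/
noncomputable def ketbra {α : Type*} (ψ : EuclideanSpace ℂ α) : Matrix α α ℂ :=
  Matrix.vecMulVec ψ.ofLp (star ψ.ofLp)

/-- The set of pure states `U_i |ψ⟩⟨ψ| U_i†` obtained by applying all unitaries of the ensemble. -/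
def UnitaryEnsemble.orbit {α : Type*} [Fintype α] [DecidableEq α] (E : UnitaryEnsemble α)
    (ψ : EuclideanSpace ℂ α) : Set (Matrix α α ℂ) :=
  Set.range fun i => ketbra (WithLp.toLp 2 ((E.unitary i).1 *ᵥ ψ.ofLp))

/-! ### Circuits on a chain of `n` qudits followed by one ancilla qubit -/

/-- Computational basis labels of `n` qudits. -/
abbrev Qudits (n q : ℕ) : Type := Fin n → Fin q

/-- Computational basis labels of `n` qudits and one ancilla qubit. -/
abbrev WithAncilla (n q : ℕ) : Type := Qudits n q × Fin 2

/-- A two-qudit gate `g` applied to qudits `i` and `j`, identity on everything else. -/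
def quditGate {n q : ℕ} (i j : Fin n) (g : Matrix (Fin q × Fin q) (Fin q × Fin q) ℂ) :
    Matrix (WithAncilla n q) (WithAncilla n q) ℂ :=
  Matrix.of fun x y =>
    if x.2 = y.2 ∧ ∀ l, l ≠ i → l ≠ j → x.1 l = y.1 l then
      g (x.1 i, x.1 j) (y.1 i, y.1 j)
    else 0

/-- A gate `h` applied to qudit `i` and the ancilla qubit, identity on everything else. -/
def ancillaGate {n q : ℕ} (i : Fin n) (h : Matrix (Fin q × Fin 2) (Fin q × Fin 2) ℂ) :
    Matrix (WithAncilla n q) (WithAncilla n q) ℂ :=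
  Matrix.of fun x y =>
    if ∀ l, l ≠ i → x.1 l = y.1 l then h (x.1 i, x.2) (y.1 i, y.2) else 0

/-- One elementary step of a circuit: an element of `G` on neighbouring qudits `i, i+1`, or an
element of `A` on the last qudit and the ancilla qubit (its neighbour on the chain). -/
def IsElementary {n q : ℕ} (G : Finset (Matrix.unitaryGroup (Fin q × Fin q) ℂ))
    (A : Finset (Matrix.unitaryGroup (Fin q × Fin 2) ℂ))
    (W : Matrix (WithAncilla n q) (WithAncilla n q) ℂ) : Prop :=
  (∃ g ∈ G, ∃ i j : Fin n, (j : ℕ) = i + 1 ∧ W = quditGate i j g.1) ∨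
    (∃ h ∈ A, ∃ i : Fin n, (i : ℕ) + 1 = n ∧ W = ancillaGate i h.1)

/-- The set of unitaries generated by local circuits of size at most `r`. -/
def circuits {n q : ℕ} (G : Finset (Matrix.unitaryGroup (Fin q × Fin q) ℂ))
    (A : Finset (Matrix.unitaryGroup (Fin q × Fin 2) ℂ)) (r : ℕ) :
    Set (Matrix (WithAncilla n q) (WithAncilla n q) ℂ) :=
  {V | ∃ L : List (Matrix (WithAncilla n q) (WithAncilla n q) ℂ),
    L.length ≤ r ∧ (∀ W ∈ L, IsElementary G A W) ∧ V = L.prod}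

/-! ### Simple measurements and strong state complexity -/

/-- Position (counted from `0`) of a computational basis vector in the lexicographic order
`|x_1 … x_n a⟩`. -/
def basisIndex {n q : ℕ} (x : WithAncilla n q) : ℕ :=
  2 * (∑ j : Fin n, (x.1 j : ℕ) * q ^ (j.rev : ℕ)) + (x.2 : ℕ)

/-- The projector `P_l` onto the first `l` computational basis vectors. -/
def basisProj (n q l : ℕ) : Matrix (WithAncilla n q) (WithAncilla n q) ℂ :=
  Matrix.diagonal fun x => if basisIndex x < l then 1 else 0

/-- The partial trace over the second tensor factor. -/
def partialTraceRight {α γ : Type*} [Fintype γ] (X : Matrix (α × γ) (α × γ) ℂ) : Matrix α α ℂ :=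
  Matrix.of fun a b => ∑ c, X (a, c) (b, c)

/-- The measurements `Tr₂ ((𝟙 ⊗ |0⟩⟨0|) V P_l V†)` with `V` a circuit of size at most `r` and
`1 ≤ l ≤ 2d`. -/
def simpleMeasurements {n q : ℕ} (G : Finset (Matrix.unitaryGroup (Fin q × Fin q) ℂ))
    (A : Finset (Matrix.unitaryGroup (Fin q × Fin 2) ℂ)) (r : ℕ) :
    Set (Matrix (Qudits n q) (Qudits n q) ℂ) :=
  {M | ∃ V ∈ circuits (n := n) G A r, ∃ l : ℕ, 1 ≤ l ∧ l ≤ 2 * q ^ n ∧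
    M = partialTraceRight
      (((1 : Matrix (Qudits n q) (Qudits n q) ℂ) ⊗ₖ Matrix.single (0 : Fin 2) 0 (1 : ℂ)) *
        (V * basisProj n q l * Vᴴ))}

/-- The maximal bias `max {|Tr (M (ρ - 𝟙/d))| : M ∈ M_r}` for distinguishing `ρ` from the maximally
mixed state. -/
noncomputable def maxBias {n q : ℕ} (G : Finset (Matrix.unitaryGroup (Fin q × Fin q) ℂ))
    (A : Finset (Matrix.unitaryGroup (Fin q × Fin 2) ℂ)) (r : ℕ)
    (ρ : Matrix (Qudits n q) (Qudits n q) ℂ) : ℝ :=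
  sSup ((fun M => ‖(M * (ρ - ((q : ℂ) ^ n)⁻¹ • (1 : Matrix (Qudits n q) (Qudits n q) ℂ))).trace‖) ''
    simpleMeasurements G A r)

/-- The strong `δ`-state complexity: the least `r` with `maxBias r ρ ≥ 1 - 1/d - δ` (`⊤` if there
is none). -/
noncomputable def stateComplexity {n q : ℕ}
    (G : Finset (Matrix.unitaryGroup (Fin q × Fin q) ℂ))
    (A : Finset (Matrix.unitaryGroup (Fin q × Fin 2) ℂ)) (δ : ℝ)
    (ρ : Matrix (Qudits n q) (Qudits n q) ℂ) : ℕ∞ :=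
  ⨅ (r : ℕ) (_ : 1 - 1 / (q : ℝ) ^ n - δ ≤ maxBias G A r ρ), (r : ℕ∞)

/-- `C(d+k-1, k) (1/(1+ε) - 2 d n^r g^r (16 k² / (d (1-δ)²))^k)` with `d = q^n`. -/
noncomputable def stateBound (q n k r g : ℕ) (ε δ : ℝ) : ℝ :=
  ((q ^ n + k - 1).choose k : ℝ) *
    (1 / (1 + ε) - 2 * (q : ℝ) ^ n * (n : ℝ) ^ r * (g : ℝ) ^ r *
      (16 * (k : ℝ) ^ 2 / ((q : ℝ) ^ n * (1 - δ) ^ 2)) ^ k)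

end DesignComplexity

open DesignComplexity

namespace DesignComplexity

/-! The proof is a moment method followed by a weighted count. Diagonalising an effect `0 ≤ M ≤ 1`
turns the bias `Tr (M (ρ - 𝟙/d))` of a pure state `φ` into `∑ j, b j * |φ_j|²` in the eigenbasis of
`M`, where the `b j` are the centred eigenvalues: they lie in `[-1, 1]` and sum to zero
(`exists_diag_of_effect`). For a Haar random state the `t`-th moment of such a quantity is `h_t(b) /
C(d+t-1, t)`, with `h_t` the complete homogeneous symmetric polynomial (`integral_observable_pow`).
Newton's identities and the vanishing of the first power sum give `|h_t(b)| ≤ d^⌊t/2⌋`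
(`abs_homSum_le`), so the `2k`-th moment is at most `(4k²/d)^k`.

The diamond norm bounds the difference between the design and Haar averages of any product of `t`
such quantities in a common basis (`abs_design_sub_haar_le`). A `2k`-design thus has the same
`2k`-th moment up to a factor `1 + ε`, and Markov's inequality bounds the weight of unitaries giving
one `M` a large bias (`design_tail_le`). The same transfer applied to the fidelity with a fixed
state shows that each state of the orbit carries weight at most `(1+ε) / C(d+k-1, k)`
(`design_weight_le`).

Circuit counting gives at most `2d (n|G|)^r` measurements. By the union bound, all weight outside
the resulting bad set sits on states of complexity at least `r+1`, and dividing it by the maximal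
weight of one state yields `L` (`stateBound_le_ncard`). For the order of magnitude, set `y = d/k² =
q^(n - 2 log_q k)`: the assumption on `r` keeps the number of circuits below `y^(k/4)`, which the
factor `y^(-k)` from the tail bound outweighs (`failure_le`). -/

/-! ### Complete homogeneous symmetric sums -/

/-- The complete homogeneous symmetric polynomial of degree `t`, evaluated at `b`. -/
noncomputable def homSum {α : Type*} [Fintype α] [DecidableEq α] (b : α → ℝ) (t : ℕ) : ℝ :=
  ∑ p ∈ Finset.piAntidiag Finset.univ t, ∏ j, b j ^ p j

/-- The generating function `∑ h_t x^t = ∏ 1/(1 - b_j x)` makes both the count at `b = 1` and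
Newton's identities formal power series computations. -/
theorem coeff_prod_geometric {α : Type*} [Fintype α] [DecidableEq α] (b : α → ℝ) (t : ℕ) :
    PowerSeries.coeff t (∏ j, PowerSeries.mk fun n => b j ^ n) = homSum b t := by
  rw [PowerSeries.coeff_prod, homSum]
  refine Finset.sum_bij' (fun f _ => (f : α → ℕ)) (fun p _ => Finsupp.equivFunOnFinite.symm p)
    ?_ ?_ ?_ ?_ ?_
  · intro f hf
    simpa using hf
  · intro p hp
    simpa using hp
  · intro f _
    ext; rfl
  · intro p _
    rfl
  · intro f _
    simp

theorem homSum_one {α : Type*} [Fintype α] [DecidableEq α] [Nonempty α] (t : ℕ) :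
    homSum (fun _ : α => 1) t = ((Fintype.card α + t - 1).choose t : ℝ) := by
  rw [← coeff_prod_geometric]
  obtain ⟨m, hm⟩ : ∃ m, Fintype.card α = m + 1 := Nat.exists_eq_succ_of_ne_zero Fintype.card_ne_zero
  have : (PowerSeries.mk fun n => (1 : ℝ) ^ n) = PowerSeries.mk 1 := by
    ext; simp
  rw [Finset.prod_const, Finset.card_univ, this, hm, PowerSeries.mk_one_pow_eq_mk_choose_add,
    PowerSeries.coeff_mk]
  norm_cast
  rw [show m + 1 + t - 1 = m + t by omega]
  rw [← Nat.choose_symm (by omega), show m + t - m = t by omega]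

/-- This is the logarithmic derivative of `∏ 1/(1 - b_j x)`, whose coefficients are the power sums
of `b`. -/
theorem derivative_prod_geometric {α : Type*} [DecidableEq α] (b : α → ℝ) (s : Finset α) :
    PowerSeries.derivative ℝ (∏ j ∈ s, PowerSeries.mk fun n => b j ^ n) =
      (∏ j ∈ s, PowerSeries.mk fun n => b j ^ n) *
        PowerSeries.mk fun n => ∑ j ∈ s, b j ^ (n + 1) := by
  induction s using Finset.induction_on with
  | empty =>
    ext n
    simp
  | insert i s hi ih =>
    have h1 : PowerSeries.derivative ℝ (PowerSeries.mk fun n => b i ^ n) =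
        (PowerSeries.mk fun n => b i ^ n) * PowerSeries.mk fun n => b i ^ (n + 1) := by
      ext n
      rw [PowerSeries.coeff_derivative, PowerSeries.coeff_mul]
      simp only [PowerSeries.coeff_mk]
      rw [Finset.sum_congr rfl (g := fun _ => b i ^ (n + 1))]
      · simp [mul_comm]
      · intro x hx
        rw [← pow_add, ← Finset.HasAntidiagonal.mem_antidiagonal.mp hx, add_assoc]
    have h2 : (PowerSeries.mk fun n => ∑ j ∈ insert i s, b j ^ (n + 1)) =
        (PowerSeries.mk fun n => b i ^ (n + 1)) + PowerSeries.mk fun n => ∑ j ∈ s, b j ^ (n + 1) := by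
      ext n
      simp [Finset.sum_insert hi]
    rw [Finset.prod_insert hi, Derivation.leibniz, ih, h1, h2]
    simp only [smul_eq_mul]
    ring

/-- Newton's identities for the complete homogeneous sums. -/
theorem newton_homSum {α : Type*} [Fintype α] [DecidableEq α] (b : α → ℝ) (t : ℕ) :
    (t + 1) * homSum b (t + 1) =
      ∑ x ∈ Finset.HasAntidiagonal.antidiagonal t, homSum b x.1 * ∑ j, b j ^ (x.2 + 1) := by
  have h := congrArg (PowerSeries.coeff t) (derivative_prod_geometric b Finset.univ)
  rw [PowerSeries.coeff_derivative, PowerSeries.coeff_mul, coeff_prod_geometric] at h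
  simp only [coeff_prod_geometric, PowerSeries.coeff_mk] at h
  rw [← h, mul_comm]

/-- Newton's identity writes `h_{t+1}` as an average of `t+1` products of an earlier `h` with a
power sum. The first power sum is zero; every other one is at most `d` and lowers the degree by at
least two, so each factor `d` pays for two degrees. -/
theorem abs_homSum_le {α : Type*} [Fintype α] [DecidableEq α] [Nonempty α] (b : α → ℝ)
    (hb : ∀ j, |b j| ≤ 1) (hsum : ∑ j, b j = 0) (t : ℕ) :
    |homSum b t| ≤ (Fintype.card α : ℝ) ^ (t / 2) := by
  have hd : (1 : ℝ) ≤ Fintype.card α := by exact_mod_cast Fintype.card_pos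
  induction t using Nat.strong_induction_on with
  | _ t ih =>
    match t with
    | 0 => simp [homSum]
    | t + 1 =>
      have hN := newton_homSum b t
      have hp : ∀ m, |∑ j, b j ^ m| ≤ (Fintype.card α : ℝ) := fun m => by
        refine (Finset.abs_sum_le_sum_abs _ _).trans ?_
        refine (Finset.sum_le_card_nsmul _ _ 1 fun j _ => ?_).trans (by simp)
        rw [abs_pow]
        exact pow_le_one₀ (abs_nonneg _) (hb j)
      have hterm : ∀ x ∈ Finset.HasAntidiagonal.antidiagonal t, |homSum b x.1 * ∑ j, b j ^ (x.2 + 1)| ≤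
          (Fintype.card α : ℝ) ^ ((t + 1) / 2) := by
        intro x hx
        have hx' := Finset.HasAntidiagonal.mem_antidiagonal.mp hx
        rcases Nat.eq_zero_or_pos x.2 with h0 | h0
        · simp only [h0, zero_add, pow_one, hsum, mul_zero, abs_zero]
          positivity
        · rw [abs_mul]
          refine (mul_le_mul (ih x.1 (by omega)) (hp _) (abs_nonneg _) (by positivity)).trans ?_
          rw [← pow_succ]
          exact pow_le_pow_right₀ hd (by omega)
      have h2 : ((t : ℝ) + 1) * |homSum b (t + 1)| ≤
          ((t : ℝ) + 1) * (Fintype.card α : ℝ) ^ ((t + 1) / 2) := by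
        rw [← abs_of_nonneg (show (0 : ℝ) ≤ (t : ℝ) + 1 by positivity), ← abs_mul,
          abs_of_nonneg (show (0 : ℝ) ≤ (t : ℝ) + 1 by positivity), hN]
        refine (Finset.abs_sum_le_sum_abs _ _).trans ?_
        refine (Finset.sum_le_card_nsmul _ _ _ hterm).trans ?_
        simp
      exact le_of_mul_le_mul_left h2 (by positivity)

/-! ### Moments of a Haar random vector -/

instance isProbabilityMeasure_haarUnitary {α : Type*} [Fintype α] [DecidableEq α] :
    IsProbabilityMeasure (haarUnitary α) :=
  ⟨by simpa [haarUnitary] using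
    Measure.haarMeasure_self (K₀ := (⊤ : TopologicalSpace.PositiveCompacts (Matrix.unitaryGroup α ℂ)))⟩

instance isMulLeftInvariant_haarUnitary {α : Type*} [Fintype α] [DecidableEq α] :
    (haarUnitary α).IsMulLeftInvariant := by
  unfold haarUnitary
  infer_instance

theorem integrable_haarUnitary_of_continuous {α F : Type*} [Fintype α] [DecidableEq α]
    [NormedAddCommGroup F] {f : Matrix.unitaryGroup α ℂ → F} (hf : Continuous f) :
    Integrable f (haarUnitary α) :=
  hf.integrable_of_hasCompactSupport (HasCompactSupport.of_compactSpace _)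

@[fun_prop]
theorem continuous_unitary_mulVec {α : Type*} [Fintype α] [DecidableEq α] (ψ : α → ℂ) (j : α) :
    Continuous fun U : Matrix.unitaryGroup α ℂ => (U.1 *ᵥ ψ) j := by
  simp only [Matrix.mulVec, dotProduct]
  have hent : ∀ i j : α, Continuous fun U : Matrix.unitaryGroup α ℂ => U.1 i j := fun i j =>
    (continuous_apply j).comp ((continuous_apply i).comp continuous_subtype_val)
  exact continuous_finsetSum _ fun i _ => (hent j i).mul continuous_const

theorem sum_norm_sq_unitary_mulVec {α : Type*} [Fintype α] [DecidableEq α]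
    (U : Matrix.unitaryGroup α ℂ) (ψ : α → ℂ) :
    ∑ j, ‖(U.1 *ᵥ ψ) j‖ ^ 2 = ∑ j, ‖ψ j‖ ^ 2 := by
  have key : ∀ φ : α → ℂ, ((∑ j, ‖φ j‖ ^ 2 : ℝ) : ℂ) = star φ ⬝ᵥ φ := fun φ => by
    simp [dotProduct, Complex.conj_mul']
  have h : star (U.1 *ᵥ ψ) ⬝ᵥ (U.1 *ᵥ ψ) = star ψ ⬝ᵥ ψ := by
    rw [Matrix.star_mulVec, Matrix.dotProduct_mulVec, Matrix.vecMul_vecMul,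
      ← Matrix.star_eq_conjTranspose, Matrix.UnitaryGroup.star_mul_self, Matrix.vecMul_one]
  exact_mod_cast (key _).trans (h.trans (key ψ).symm)

/-- Every unit vector is a column of a unitary matrix. -/
theorem exists_unitary_col {α : Type*} [Fintype α] [DecidableEq α] (v : α → ℂ)
    (hv : ∑ j, ‖v j‖ ^ 2 = 1) (j₀ : α) :
    ∃ V : Matrix.unitaryGroup α ℂ, ∀ i, V.1 i j₀ = v i := by
  have hn : ‖WithLp.toLp 2 v‖ = 1 := by
    rw [EuclideanSpace.norm_eq]
    simp [hv]
  have ho : Orthonormal ℂ (({j₀} : Set α).domRestrict fun _ : α => WithLp.toLp 2 v) := by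
    refine ⟨fun _ => hn, fun i j hij => (hij ?_).elim⟩
    exact Subsingleton.elim _ _
  obtain ⟨b, hb⟩ := ho.exists_orthonormalBasis_extension_of_card_eq (by simp)
  refine ⟨⟨_, (EuclideanSpace.basisFun α ℂ).toMatrix_orthonormalBasis_mem_unitary b⟩, fun i => ?_⟩
  simp [Module.Basis.toMatrix_apply, hb j₀ rfl]

/-- Left invariance rotates `v` to a multiple of a basis vector, so the moment depends only on the
norm of `v`. -/
theorem integral_dotProduct_unitary {α : Type*} [Fintype α] [DecidableEq α] (ψ v : α → ℂ)
    (j₀ : α) (t : ℕ) :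
    ∫ U, (‖star v ⬝ᵥ (U.1 *ᵥ ψ)‖ ^ 2) ^ t ∂(haarUnitary α) =
      (∑ j, ‖v j‖ ^ 2) ^ t * ∫ U, (‖(U.1 *ᵥ ψ) j₀‖ ^ 2) ^ t ∂(haarUnitary α) := by
  set S := ∑ j, ‖v j‖ ^ 2 with hS
  have hS0 : 0 ≤ S := Finset.sum_nonneg fun j _ => by positivity
  rcases hS0.eq_or_lt with h0 | hpos
  · have hv : v = 0 := by
      ext j
      have := (Finset.sum_eq_zero_iff_of_nonneg fun j _ => by positivity).mp h0.symm j
        (Finset.mem_univ j)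
      simpa using this
    rw [← h0, hv]
    rcases Nat.eq_zero_or_pos t with rfl | ht
    · simp
    · simp [ht.ne']
  · have hsq : √S ^ 2 = S := Real.sq_sqrt hS0
    have hs : 0 < √S := Real.sqrt_pos.mpr hpos
    obtain ⟨V, hV⟩ := exists_unitary_col (fun j => ((√S)⁻¹ : ℂ) * v j) (by
      simp only [norm_mul, mul_pow, ← Finset.mul_sum, ← hS]
      simp [hsq, hpos.ne']) j₀
    rw [← integral_mul_left_eq_self (fun U => (‖star v ⬝ᵥ (U.1 *ᵥ ψ)‖ ^ 2) ^ t) V,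
      ← integral_const_mul]
    congr 1
    ext U
    rw [← mul_pow]
    congr 1
    have h1 : star v ᵥ* V.1 = fun j => (√S : ℂ) * star (V.1 · j₀) ⬝ᵥ (V.1 · j) := by
      ext j
      simp only [Matrix.vecMul, dotProduct, Pi.star_apply, hV, Finset.mul_sum]
      refine Finset.sum_congr rfl fun i _ => ?_
      have : (√S : ℂ) ≠ 0 := by exact_mod_cast hs.ne'
      simp only [star_mul', ← mul_assoc]
      simp [this]
    have h2 : star v ᵥ* V.1 = Pi.single j₀ (√S : ℂ) := by
      rw [h1]
      ext j
      have := congrFun (congrFun (Matrix.UnitaryGroup.star_mul_self V) j₀) j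
      simp only [Matrix.mul_apply, Matrix.star_apply, Matrix.one_apply] at this
      simp only [dotProduct, Pi.star_apply, this]
      by_cases h : j₀ = j
      · subst h; simp
      · simp [h, Ne.symm h]
    have h3 : star v ⬝ᵥ ((V * U).1 *ᵥ ψ) = (√S : ℂ) * (U.1 *ᵥ ψ) j₀ := by
      rw [show (V * U).1 = V.1 * U.1 from rfl, ← Matrix.mulVec_mulVec, Matrix.dotProduct_mulVec, h2,
        single_dotProduct]
    rw [h3, norm_mul, mul_pow]
    simp [hsq]

/-- Mixed moments of different multidegrees vanish, by invariance under diagonal phases. -/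
theorem integral_monomial_eq_zero {α : Type*} [Fintype α] [DecidableEq α] (ψ : α → ℂ)
    {p p' : α → ℕ} (h : p ≠ p') :
    ∫ U, (∏ j, (U.1 *ᵥ ψ) j ^ p j) * (∏ j, star ((U.1 *ᵥ ψ) j) ^ p' j) ∂(haarUnitary α) = 0 := by
  obtain ⟨i, hi⟩ := Function.ne_iff.mp h
  -- With this phase on coordinate `i`, the monomial acquires `z^(p i - p' i) = exp(iπ) = -1`, so
  -- the integral equals its own negative.
  set z : ℂ := Complex.exp ((Real.pi / ((p i : ℝ) - p' i) : ℝ) * Complex.I) with hz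
  have hz1 : z * star z = 1 := by
    rw [Complex.star_def, Complex.mul_conj', hz, Complex.norm_exp_ofReal_mul_I]; simp
  have hzz : z ^ p i * star z ^ p' i = -1 := by
    have hst : star z = Complex.exp (-((Real.pi / ((p i : ℝ) - p' i) : ℝ) * Complex.I)) := by
      rw [hz, Complex.star_def, ← Complex.exp_conj]
      simp
    have hne : (p i : ℂ) - p' i ≠ 0 := by
      rw [sub_ne_zero]; exact_mod_cast hi
    rw [hst, hz, ← Complex.exp_nat_mul, ← Complex.exp_nat_mul, ← Complex.exp_add,
      ← Complex.exp_pi_mul_I]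
    congr 1
    push_cast
    field_simp
    ring
  let D : Matrix.unitaryGroup α ℂ := ⟨Matrix.diagonal fun j => if j = i then z else 1, by
    rw [Matrix.mem_unitaryGroup_iff, Matrix.star_eq_conjTranspose, Matrix.diagonal_conjTranspose,
      Matrix.diagonal_mul_diagonal, ← Matrix.diagonal_one]
    congr 1
    ext j
    by_cases hj : j = i
    · simpa [hj] using hz1
    · simp [hj]⟩
  have hI := integral_mul_left_eq_self (μ := haarUnitary α) (fun U =>
    (∏ j, (U.1 *ᵥ ψ) j ^ p j) * (∏ j, star ((U.1 *ᵥ ψ) j) ^ p' j)) D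
  have hD : ∀ U : Matrix.unitaryGroup α ℂ, ∀ j, ((D * U).1 *ᵥ ψ) j =
      (if j = i then z else 1) * (U.1 *ᵥ ψ) j := by
    intro U j
    rw [show (D * U).1 = D.1 * U.1 from rfl, ← Matrix.mulVec_mulVec]
    simp [D, Matrix.mulVec_diagonal]
  have hprod : ∀ (f : α → ℂ) (y : ℂ) (e : α → ℕ), ∏ j, ((if j = i then y else 1) * f j) ^ e j =
      y ^ e i * ∏ j, f j ^ e j := by
    intro f y e
    simp only [mul_pow, Finset.prod_mul_distrib]
    congr 1
    rw [Finset.prod_eq_single i] <;> simp +contextual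
  have hU : ∀ U : Matrix.unitaryGroup α ℂ,
      (∏ j, ((D * U).1 *ᵥ ψ) j ^ p j) * (∏ j, star (((D * U).1 *ᵥ ψ) j) ^ p' j) =
      -((∏ j, (U.1 *ᵥ ψ) j ^ p j) * (∏ j, star ((U.1 *ᵥ ψ) j) ^ p' j)) := by
    intro U
    have : ∀ j, star (((D * U).1 *ᵥ ψ) j) = (if j = i then star z else 1) * star ((U.1 *ᵥ ψ) j) := by
      intro j
      rw [hD, star_mul']
      split_ifs <;> simp
    simp only [this, hprod]
    simp only [hD, hprod]
    linear_combination (∏ j, (U.1 *ᵥ ψ) j ^ p j) * (∏ j, star ((U.1 *ᵥ ψ) j) ^ p' j) * hzz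
  simp only [hU] at hI
  rw [integral_neg] at hI
  exact self_eq_neg.mp hI.symm

/-- Polynomials agreeing on a product of infinite sets are equal. The nonnegative orthant is the
domain needed, since the lemma is applied to squared moduli. -/
theorem coeff_unique_of_nonneg {α : Type*} [Fintype α] [DecidableEq α] (S : Finset (α → ℕ))
    (a a' : (α → ℕ) → ℝ)
    (h : ∀ s : α → ℝ, (∀ j, 0 ≤ s j) →
      ∑ p ∈ S, a p * ∏ j, s j ^ p j = ∑ p ∈ S, a' p * ∏ j, s j ^ p j) :
    ∀ p ∈ S, a p = a' p := by
  let P : ((α → ℕ) → ℝ) → MvPolynomial α ℝ := fun a =>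
    ∑ p ∈ S, MvPolynomial.monomial (Finsupp.equivFunOnFinite.symm p) (a p)
  have heval : ∀ a s, MvPolynomial.eval s (P a) = ∑ p ∈ S, a p * ∏ j, s j ^ p j := by
    intro a s
    simp only [P, map_sum, MvPolynomial.eval_monomial]
    refine Finset.sum_congr rfl fun p _ => ?_
    rw [Finsupp.prod_fintype _ _ (by simp)]
    simp
  have hcoeff : ∀ a, ∀ p ∈ S, (P a).coeff (Finsupp.equivFunOnFinite.symm p) = a p := by
    intro a p hp
    simp only [P, MvPolynomial.coeff_sum, MvPolynomial.coeff_monomial, EmbeddingLike.apply_eq_iff_eq]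
    simp [hp]
  have hPQ : P a = P a' := MvPolynomial.funext_set (fun _ => Set.Ici 0) (fun _ => Set.Ici_infinite 0)
    fun s hs => by
      rw [heval, heval]
      exact h s fun j => hs j (Set.mem_univ j)
  intro p hp
  rw [← hcoeff a p hp, hPQ, hcoeff a' p hp]

/-- Take `v_j = √s_j` in `integral_dotProduct_unitary` and expand both sides in `s`. The cross terms
vanish by `integral_monomial_eq_zero`, so the left side has coefficients `M p ^ 2 * m p` and the
right side `c * M p`, with `M` the multinomial coefficient. -/
theorem multinomial_mul_integral_monomial {α : Type*} [Fintype α] [DecidableEq α] (ψ : α → ℂ)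
    (j₀ : α) (t : ℕ) {p : α → ℕ} (hp : p ∈ Finset.piAntidiag Finset.univ t) :
    Nat.multinomial Finset.univ p * ∫ U, ∏ j, (‖(U.1 *ᵥ ψ) j‖ ^ 2) ^ p j ∂(haarUnitary α) =
      ∫ U, (‖(U.1 *ᵥ ψ) j₀‖ ^ 2) ^ t ∂(haarUnitary α) := by
  set c := ∫ U, (‖(U.1 *ᵥ ψ) j₀‖ ^ 2) ^ t ∂(haarUnitary α)
  set m : (α → ℕ) → ℝ := fun p => ∫ U, ∏ j, (‖(U.1 *ᵥ ψ) j‖ ^ 2) ^ p j ∂(haarUnitary α) with hm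
  let M : (α → ℕ) → ℝ := fun p => Nat.multinomial Finset.univ p
  have hmC : ∀ p, ∫ U, (∏ j, (U.1 *ᵥ ψ) j ^ p j) * (∏ j, star ((U.1 *ᵥ ψ) j) ^ p j)
      ∂(haarUnitary α) = (m p : ℂ) := by
    intro p
    rw [hm]
    simp only
    rw [← integral_complex_ofReal]
    congr 1
    ext U
    rw [← Finset.prod_mul_distrib]
    push_cast
    refine Finset.prod_congr rfl fun j _ => ?_
    rw [← mul_pow, Complex.star_def, Complex.mul_conj']
  have key : ∀ p ∈ Finset.piAntidiag Finset.univ t, M p ^ 2 * m p = c * M p := by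
    refine coeff_unique_of_nonneg _ _ _ fun s hs => ?_
    have h1 := integral_dotProduct_unitary ψ (fun j => (√(s j) : ℂ)) j₀ t
    have h2 : ∑ j, ‖((√(s j) : ℝ) : ℂ)‖ ^ 2 = ∑ j, s j :=
      Finset.sum_congr rfl fun j _ => by simp [Real.sq_sqrt (hs j)]
    rw [h2, Finset.sum_pow_eq_sum_piAntidiag] at h1
    have h3 : ∀ U : Matrix.unitaryGroup α ℂ,
        (((‖(star fun j => ((√(s j) : ℝ) : ℂ)) ⬝ᵥ (U.1 *ᵥ ψ)‖ ^ 2) ^ t : ℝ) : ℂ) =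
        ∑ p ∈ Finset.piAntidiag Finset.univ t, ∑ p' ∈ Finset.piAntidiag Finset.univ t,
          ((M p : ℂ) * M p' * (∏ j, ((√(s j) : ℝ) : ℂ) ^ p j) * (∏ j, ((√(s j) : ℝ) : ℂ) ^ p' j)) *
          ((∏ j, (U.1 *ᵥ ψ) j ^ p j) * (∏ j, star ((U.1 *ᵥ ψ) j) ^ p' j)) := by
      intro U
      have h4 : (star fun j => ((√(s j) : ℝ) : ℂ)) ⬝ᵥ (U.1 *ᵥ ψ) =
          ∑ j, ((√(s j) : ℝ) : ℂ) * (U.1 *ᵥ ψ) j := by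
        simp [dotProduct]
      rw [h4]
      push_cast
      rw [← Complex.mul_conj', mul_pow, ← Complex.star_def, star_sum,
        Finset.sum_pow_eq_sum_piAntidiag, Finset.sum_pow_eq_sum_piAntidiag, Finset.sum_mul_sum]
      refine Finset.sum_congr rfl fun p _ => Finset.sum_congr rfl fun p' _ => ?_
      simp only [star_mul', mul_pow, Finset.prod_mul_distrib, M]
      simp only [Complex.star_def, Complex.conj_ofReal, Complex.ofReal_natCast]
      ring
    have h5 := congrArg (fun x : ℝ => (x : ℂ)) h1
    simp only [← integral_complex_ofReal, h3] at h5
    rw [integral_finsetSum _ fun p _ => integrable_haarUnitary_of_continuous (by fun_prop)] at h5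
    have h6 : ∀ p ∈ Finset.piAntidiag Finset.univ t, ∫ U, ∑ p' ∈ Finset.piAntidiag Finset.univ t,
          ((M p : ℂ) * M p' * (∏ j, ((√(s j) : ℝ) : ℂ) ^ p j) * (∏ j, ((√(s j) : ℝ) : ℂ) ^ p' j)) *
          ((∏ j, (U.1 *ᵥ ψ) j ^ p j) * (∏ j, star ((U.1 *ᵥ ψ) j) ^ p' j)) ∂(haarUnitary α) =
          ((M p ^ 2 * m p * ∏ j, s j ^ p j : ℝ) : ℂ) := by
      intro p hp
      rw [integral_finsetSum _ fun p _ => integrable_haarUnitary_of_continuous (by fun_prop),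
        Finset.sum_eq_single_of_mem p hp]
      · rw [integral_const_mul, hmC]
        have : (∏ j, s j ^ p j) = (∏ j, √(s j) ^ p j) * (∏ j, √(s j) ^ p j) := by
          rw [← Finset.prod_mul_distrib]
          refine Finset.prod_congr rfl fun j _ => ?_
          rw [← mul_pow, Real.mul_self_sqrt (hs j)]
        rw [this]
        push_cast
        ring
      · intro p' _ hpp
        rw [integral_const_mul, integral_monomial_eq_zero ψ hpp.symm, mul_zero]
    rw [Finset.sum_congr rfl h6] at h5
    have h7 : ∑ p ∈ Finset.piAntidiag Finset.univ t, M p ^ 2 * m p * ∏ j, s j ^ p j =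
        (∑ p ∈ Finset.piAntidiag Finset.univ t, M p * ∏ j, s j ^ p j) * c := by
      exact_mod_cast h5
    rw [h7, Finset.sum_mul]
    exact Finset.sum_congr rfl fun p _ => by ring
  have hM : M p ≠ 0 := by
    simp only [M]; exact_mod_cast (Nat.multinomial_pos _ _).ne'
  have := key p hp
  exact mul_left_cancel₀ hM (by linear_combination this)

/-- The moments of a diagonal observable in a Haar random pure state. -/
theorem integral_observable_pow {α : Type*} [Fintype α] [DecidableEq α] [Nonempty α] (ψ : α → ℂ)
    (hψ : ∑ j, ‖ψ j‖ ^ 2 = 1) (b : α → ℝ) (t : ℕ) :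
    ∫ U, (∑ j, b j * ‖(U.1 *ᵥ ψ) j‖ ^ 2) ^ t ∂(haarUnitary α) =
      homSum b t / ((Fintype.card α + t - 1).choose t : ℝ) := by
  obtain ⟨j₀⟩ := ‹Nonempty α›
  set c := ∫ U, (‖(U.1 *ᵥ ψ) j₀‖ ^ 2) ^ t ∂(haarUnitary α) with hc
  have main : ∀ b : α → ℝ, ∫ U, (∑ j, b j * ‖(U.1 *ᵥ ψ) j‖ ^ 2) ^ t ∂(haarUnitary α) =
      c * homSum b t := by
    intro b
    simp only [Finset.sum_pow_eq_sum_piAntidiag]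
    rw [integral_finsetSum _ fun p _ => integrable_haarUnitary_of_continuous (by fun_prop), homSum,
      Finset.mul_sum]
    refine Finset.sum_congr rfl fun p hp => ?_
    rw [integral_const_mul]
    simp only [mul_pow _ (‖_‖ ^ 2), Finset.prod_mul_distrib]
    rw [integral_const_mul, hc, ← multinomial_mul_integral_monomial ψ j₀ t hp]
    ring
  -- The constant observable `1` has all moments equal to `1`, which fixes `c`.
  have h1 := main fun _ => 1
  simp only [one_mul, sum_norm_sq_unitary_mulVec, hψ, one_pow, integral_const, probReal_univ,
    smul_eq_mul, mul_one] at h1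
  rw [homSum_one] at h1
  have hD : ((Fintype.card α + t - 1).choose t : ℝ) ≠ 0 := fun h => by
    rw [h, mul_zero] at h1
    exact one_ne_zero h1
  rw [main, eq_div_iff hD]
  linear_combination -homSum b t * h1

/-! ### Trace norm duality and approximate designs -/

section
open scoped Matrix.Norms.L2Operator

/-- Evaluate the trace in an eigenbasis of `Yᴴ * Y`: the vector `Y v_i` has norm equal to the `i`-th
singular value, and Cauchy–Schwarz bounds each diagonal term. -/
theorem norm_trace_mul_le {β : Type*} [Fintype β] [DecidableEq β] (O Y : Matrix β β ℂ) :
    ‖(O * Y).trace‖ ≤ ‖O‖ * traceNorm Y := by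
  set H := Matrix.isHermitian_conjTranspose_mul_self Y
  let v := H.eigenvectorBasis
  have h1 : (O * Y).trace = ∑ i, inner ℂ (v i) (Matrix.toEuclideanCLM (𝕜 := ℂ) (O * Y) (v i)) := by
    have := LinearMap.trace_eq_sum_inner (Matrix.toEuclideanLin (𝕜 := ℂ) (O * Y)) v
    rw [← Matrix.coe_toEuclideanCLM_eq_toEuclideanLin] at this
    refine Eq.trans ?_ this
    rw [Matrix.coe_toEuclideanCLM_eq_toEuclideanLin, Matrix.toEuclideanLin_eq_toLin_orthonormal,
      Matrix.trace_toLin_eq]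
  rw [h1, traceNorm, Finset.mul_sum]
  refine (norm_sum_le _ _).trans (Finset.sum_le_sum fun i _ => ?_)
  have h2 : ‖Matrix.toEuclideanCLM (𝕜 := ℂ) Y (v i)‖ = √(H.eigenvalues i) := by
    rw [eq_comm, Real.sqrt_eq_iff_eq_sq (Matrix.eigenvalues_conjTranspose_mul_self_nonneg Y i)
      (norm_nonneg _)]
    have h3 : H.eigenvalues i = RCLike.re (star ⇑(v i) ⬝ᵥ (Yᴴ * Y) *ᵥ ⇑(v i)) := H.eigenvalues_eq i
    rw [h3, ← inner_self_eq_norm_sq (𝕜 := ℂ), EuclideanSpace.inner_eq_star_dotProduct,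
      Matrix.ofLp_toEuclideanCLM, dotProduct_comm (Y *ᵥ _), Matrix.star_mulVec,
      ← Matrix.dotProduct_mulVec, Matrix.mulVec_mulVec]
  rw [map_mul, ← h2]
  refine (norm_inner_le_norm _ _).trans ?_
  rw [v.norm_eq_one, one_mul, mul_apply_eq_comp]
  exact ContinuousLinearMap.le_opNorm _ _

end

/-- The matrix is a rank-one projector, so the eigenvalues of `Xᴴ * X` are idempotent and equal
their own square roots; the trace norm is the trace. -/
theorem traceNorm_vecMulVec_star {β : Type*} [Fintype β] [DecidableEq β] (x : β → ℂ)
    (hx : star x ⬝ᵥ x = 1) : traceNorm (Matrix.vecMulVec x (star x)) = 1 := by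
  set X := Matrix.vecMulVec x (star x) with hX
  have hXH : Xᴴ = X := by
    rw [hX, Matrix.conjTranspose_vecMulVec, star_star]
  have hXX : Xᴴ * X = X := by
    rw [hXH, hX, Matrix.vecMulVec_mul_vecMulVec, hx, one_smul]
  set H := Matrix.isHermitian_conjTranspose_mul_self X
  have hsq : ∀ i, H.eigenvalues i * H.eigenvalues i = H.eigenvalues i := by
    intro i
    have h1 := H.mulVec_eigenvectorBasis i
    have h2 : (Xᴴ * X) *ᵥ ((Xᴴ * X) *ᵥ (H.eigenvectorBasis i).ofLp) =
        (Xᴴ * X) *ᵥ (H.eigenvectorBasis i).ofLp := by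
      rw [Matrix.mulVec_mulVec]
      congr 1
      rw [hXX]
      rw [hXH] at hXX
      exact hXX
    rw [h1, Matrix.mulVec_smul, h1, smul_smul] at h2
    have hne : (H.eigenvectorBasis i).ofLp ≠ 0 := by
      intro h0
      have := H.eigenvectorBasis.orthonormal.ne_zero i
      exact this (by ext j; exact congrFun h0 j)
    exact smul_left_injective ℝ hne h2
  have htr : ∑ i, H.eigenvalues i = 1 := by
    have h3 := H.trace_eq_sum_eigenvalues
    have h4 : (Xᴴ * X).trace = 1 := by
      rw [hXX, hX, Matrix.trace_vecMulVec, dotProduct_comm, hx]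
    exact Complex.ofReal_injective (by simpa using h3.symm.trans h4)
  rw [traceNorm, ← htr]
  refine Finset.sum_congr rfl fun i _ => ?_
  rw [← hsq i, Real.sqrt_mul_self (Matrix.eigenvalues_conjTranspose_mul_self_nonneg X i), hsq i]

section
open scoped Matrix.Norms.L2Operator

/-- The diamond norm controls the diagonal of the output on a pure state in any orthonormal
basis. -/
theorem norm_sum_diag_le_of_diamondNorm_le {β : Type*} [Fintype β] [DecidableEq β] [Nonempty β]
    (Φ : Matrix β β ℂ →ₗ[ℂ] Matrix β β ℂ) {η : ℝ} (hη : 0 ≤ η)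
    (hΦ : diamondNorm Φ ≤ ENNReal.ofReal η) (x : β → ℂ) (hx : star x ⬝ᵥ x = 1)
    (W : Matrix.unitaryGroup β ℂ) (f : β → ℂ) (hf : ∀ a, ‖f a‖ ≤ 1) :
    ‖∑ a, f a * (W.1ᴴ * Φ (Matrix.vecMulVec x (star x)) * W.1) a a‖ ≤ η := by
  obtain ⟨a₀⟩ := ‹Nonempty β›
  -- The memory of the diamond norm is left idle in the basis state `a₀`.
  let y : β × β → ℂ := fun p => x p.1 * if a₀ = p.2 then 1 else 0
  let X := Matrix.vecMulVec y (star y)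
  have hy : star y ⬝ᵥ y = 1 := by
    rw [← hx]
    simp [dotProduct, y, Fintype.sum_prod_type]
  have hamp : ampliation β Φ X = Φ (Matrix.vecMulVec x (star x)) ⊗ₖ Matrix.single a₀ a₀ 1 := by
    ext p p'
    have : (Matrix.of fun a b => X (a, p.2) (b, p'.2)) =
        (Matrix.single a₀ a₀ (1 : ℂ) p.2 p'.2) • Matrix.vecMulVec x (star x) := by
      ext a b
      simp only [X, y, Matrix.vecMulVec_apply, Matrix.single_apply, Matrix.of_apply,
        Matrix.smul_apply, Pi.star_apply, smul_eq_mul, star_mul', apply_ite star, star_one,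
        star_zero, ite_and]
      split_ifs <;> simp
    simp only [ampliation, Matrix.of_apply, this, map_smul, Matrix.smul_apply, smul_eq_mul,
      Matrix.kroneckerMap_apply]
    ring
  have hle : traceNorm (ampliation β Φ X) ≤ η := by
    rw [← ENNReal.ofReal_le_ofReal_iff hη]
    refine le_trans ?_ hΦ
    rw [diamondNorm]
    exact le_iSup₂_of_le X (traceNorm_vecMulVec_star y hy).le le_rfl
  let V : Matrix.unitaryGroup (β × β) ℂ :=
    ⟨W.1 ⊗ₖ 1, Matrix.kronecker_mem_unitary W.2 (one_mem _)⟩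
  -- The test observable is `W diag(f) Wᴴ ⊗ 1`, of operator norm at most one because `|f| ≤ 1`.
  let D : Matrix (β × β) (β × β) ℂ := Matrix.diagonal fun p => f p.1
  have hO : ‖V.1 * D * V.1ᴴ‖ ≤ 1 := by
    have h1 : V.1ᴴ ∈ unitary (Matrix (β × β) (β × β) ℂ) := Unitary.star_mem V.2
    rw [CStarRing.norm_mul_mem_unitary _ h1, CStarRing.norm_mem_unitary_mul _ V.2,
      Matrix.l2_opNorm_diagonal]
    exact (pi_norm_le_iff_of_nonneg zero_le_one).mpr fun p => hf p.1
  have htr : (V.1 * D * V.1ᴴ * ampliation β Φ X).trace =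
      ∑ a, f a * (W.1ᴴ * Φ (Matrix.vecMulVec x (star x)) * W.1) a a := by
    rw [Matrix.mul_assoc, Matrix.mul_assoc, Matrix.trace_mul_comm, Matrix.mul_assoc, hamp]
    simp only [V, Matrix.conjTranspose_kronecker, Matrix.conjTranspose_one]
    rw [← Matrix.mul_kronecker_mul, ← Matrix.mul_kronecker_mul, Matrix.one_mul, Matrix.mul_one]
    simp only [D, Matrix.trace, Matrix.diag_apply, Matrix.diagonal_mul, Matrix.kronecker_apply,
      Fintype.sum_prod_type]
    refine Finset.sum_congr rfl fun a _ => ?_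
    rw [Finset.sum_eq_single a₀]
    · simp
    · intro c _ hc
      simp [hc.symm]
    · simp
  rw [← htr]
  refine (norm_trace_mul_le _ _).trans ?_
  have h0 : 0 ≤ traceNorm (ampliation β Φ X) := Finset.sum_nonneg fun i _ => Real.sqrt_nonneg _
  nlinarith

end

theorem tensorPower_mul {α : Type*} [Fintype α] (t : ℕ) (A B : Matrix α α ℂ) :
    tensorPower t A * tensorPower t B = tensorPower t (A * B) := by
  ext a b
  simp only [tensorPower, Matrix.mul_apply, Matrix.of_apply, ← Finset.prod_mul_distrib,
    Fintype.prod_sum]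

theorem tensorPower_conjTranspose {α : Type*} (t : ℕ) (A : Matrix α α ℂ) :
    (tensorPower t A)ᴴ = tensorPower t Aᴴ := by
  ext a b
  simp [tensorPower, Matrix.conjTranspose_apply]

theorem tensorPower_one {α : Type*} [DecidableEq α] (t : ℕ) :
    tensorPower t (1 : Matrix α α ℂ) = 1 := by
  ext a b
  simp only [tensorPower, Matrix.of_apply, Matrix.one_apply, funext_iff]
  rw [Finset.prod_ite_zero]
  simp

/-- The tensor power of a unitary matrix as a unitary matrix. -/
def tensorPowerUnitary {α : Type*} [Fintype α] [DecidableEq α] (t : ℕ)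
    (V : Matrix.unitaryGroup α ℂ) : Matrix.unitaryGroup (Fin t → α) ℂ :=
  ⟨tensorPower t V.1, by
    rw [Matrix.mem_unitaryGroup_iff, Matrix.star_eq_conjTranspose, tensorPower_conjTranspose,
      tensorPower_mul, ← Matrix.star_eq_conjTranspose, Matrix.mem_unitaryGroup_iff.mp V.2,
      tensorPower_one]⟩

theorem tensorPower_mulVec {α : Type*} [Fintype α] (t : ℕ) (A : Matrix α α ℂ) (ψ : α → ℂ) :
    tensorPower t A *ᵥ (fun a => ∏ s, ψ (a s)) = fun a => ∏ s, (A *ᵥ ψ) (a s) := by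
  ext a
  simp only [tensorPower, Matrix.mulVec, dotProduct, Matrix.of_apply, ← Finset.prod_mul_distrib,
    Fintype.prod_sum]

theorem tensorConj_diag {α : Type*} [Fintype α] [DecidableEq α] (t : ℕ)
    (U V : Matrix.unitaryGroup α ℂ) (ψ : α → ℂ) (a : Fin t → α) :
    ((tensorPowerUnitary t V).1ᴴ *
      tensorConj t U (Matrix.vecMulVec (fun a => ∏ s, ψ (a s)) (star fun a => ∏ s, ψ (a s))) *
      (tensorPowerUnitary t V).1) a a =
      ((∏ s, ‖((V⁻¹ * U).1 *ᵥ ψ) (a s)‖ ^ 2 : ℝ) : ℂ) := by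
  set Ψ : (Fin t → α) → ℂ := fun a => ∏ s, ψ (a s)
  have h1 : (tensorPowerUnitary t V).1ᴴ * tensorPower t U.1 = tensorPower t (V⁻¹ * U).1 := by
    rw [show (tensorPowerUnitary t V).1 = tensorPower t V.1 from rfl, tensorPower_conjTranspose,
      tensorPower_mul]
    rfl
  have h2 : (tensorPowerUnitary t V).1ᴴ * tensorConj t U (Matrix.vecMulVec Ψ (star Ψ)) *
      (tensorPowerUnitary t V).1 =
      Matrix.vecMulVec (tensorPower t (V⁻¹ * U).1 *ᵥ Ψ) (star (tensorPower t (V⁻¹ * U).1 *ᵥ Ψ)) := by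
    rw [Matrix.star_mulVec, ← Matrix.vecMulVec_mul, ← Matrix.mul_vecMulVec, ← h1,
      Matrix.conjTranspose_mul, Matrix.conjTranspose_conjTranspose]
    simp only [tensorConj, LinearMap.coe_mk, AddHom.coe_mk, Matrix.mul_assoc]
  rw [h2, tensorPower_mulVec, Matrix.vecMulVec_apply, Pi.star_apply, Complex.star_def,
    Complex.mul_conj', norm_prod]
  push_cast
  rw [Finset.prod_pow]

/-- Each tensor slot `s` may carry its own diagonal observable `c s`. This freedom lets a
`2k`-design control the `2k`-th moment of one observable and also, with trivial slots, the `k`-th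
moment of another. -/
theorem abs_design_sub_haar_le {α : Type*} [Fintype α] [DecidableEq α] [Nonempty α]
    (E : UnitaryEnsemble α) {ε : ℝ} (hε : 0 ≤ ε) {t : ℕ} (hE : E.IsApproxDesign ε t)
    (ψ : α → ℂ) (hψ : ∑ j, ‖ψ j‖ ^ 2 = 1) (V : Matrix.unitaryGroup α ℂ) (c : Fin t → α → ℝ)
    (hc : ∀ s j, |c s j| ≤ 1) :
    |∑ i, E.weight i * ∏ s, ∑ j, c s j * ‖((V⁻¹ * E.unitary i).1 *ᵥ ψ) j‖ ^ 2 -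
      ∫ U, ∏ s, ∑ j, c s j * ‖(U.1 *ᵥ ψ) j‖ ^ 2 ∂(haarUnitary α)| ≤
      (t.factorial : ℝ) / (Fintype.card α : ℝ) ^ (2 * t) * ε := by
  set Ψ : (Fin t → α) → ℂ := fun a => ∏ s, ψ (a s) with hΨ
  have hnorm : star Ψ ⬝ᵥ Ψ = 1 := by
    have h1 : star ψ ⬝ᵥ ψ = 1 := by
      have : star ψ ⬝ᵥ ψ = ((∑ j, ‖ψ j‖ ^ 2 : ℝ) : ℂ) := by
        simp [dotProduct, Complex.conj_mul']
      rw [this, hψ, Complex.ofReal_one]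
    have h2 : ∏ _s : Fin t, star ψ ⬝ᵥ ψ = star Ψ ⬝ᵥ Ψ := by
      simp only [dotProduct, Fintype.prod_sum, hΨ, Pi.star_apply, star_prod,
        Finset.prod_mul_distrib]
    rw [← h2, h1]
    simp
  have hfac : ∀ u : α → ℝ, ∏ s, ∑ j, c s j * u j =
      ∑ a : Fin t → α, (∏ s, c s (a s)) * ∏ s, u (a s) := by
    intro u
    simp only [Fintype.prod_sum, Finset.prod_mul_distrib]
  have key := norm_sum_diag_le_of_diamondNorm_le _ (by positivity) hE Ψ hnorm
    (tensorPowerUnitary t V) (fun a => ((∏ s, c s (a s) : ℝ) : ℂ)) (fun a => by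
      rw [Complex.norm_real, Real.norm_eq_abs, Finset.abs_prod]
      exact Finset.prod_le_one (fun _ _ => abs_nonneg _) fun _ _ => hc _ _)
  have hens : ∀ a, ((tensorPowerUnitary t V).1ᴴ * E.twirl t (Matrix.vecMulVec Ψ (star Ψ)) *
      (tensorPowerUnitary t V).1) a a =
      ((∑ i, E.weight i * ∏ s, ‖((V⁻¹ * E.unitary i).1 *ᵥ ψ) (a s)‖ ^ 2 : ℝ) : ℂ) := by
    intro a
    simp only [UnitaryEnsemble.twirl, LinearMap.sum_apply, LinearMap.smul_apply, Matrix.mul_sum,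
      Matrix.sum_mul, Matrix.mul_smul, Matrix.smul_mul, Matrix.sum_apply, Matrix.smul_apply,
      tensorConj_diag, hΨ, smul_eq_mul]
    push_cast
    rfl
  have hhaar : ∀ a, ((tensorPowerUnitary t V).1ᴴ * haarTwirl α t (Matrix.vecMulVec Ψ (star Ψ)) *
      (tensorPowerUnitary t V).1) a a =
      ((∫ U, ∏ s, ‖(U.1 *ᵥ ψ) (a s)‖ ^ 2 ∂(haarUnitary α) : ℝ) : ℂ) := by
    intro a
    -- The change of basis `V⁻¹` is absorbed by left invariance, so the Haar side does not depend on
    -- `V`.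
    rw [← integral_mul_left_eq_self (fun U : Matrix.unitaryGroup α ℂ =>
      ∏ s, ‖(U.1 *ᵥ ψ) (a s)‖ ^ 2) V⁻¹, ← integral_complex_ofReal]
    simp only [← tensorConj_diag]
    have hint : ∀ b b', Integrable (fun U => tensorConj t U (Matrix.vecMulVec Ψ (star Ψ)) b b')
      (haarUnitary α) := integrable_tensorConj t _
    simp only [Matrix.mul_apply (M := _ * _), Matrix.mul_apply (N := (tensorConj t _) _),
      Matrix.mul_apply (N := (haarTwirl α t) _)]
    rw [integral_finsetSum _ fun b _ => (integrable_finsetSum _ fun b' _ =>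
      (hint b' b).const_mul _).mul_const _]
    refine Finset.sum_congr rfl fun b _ => ?_
    rw [integral_mul_const, integral_finsetSum _ fun b' _ => (hint b' b).const_mul _]
    congr 1
    refine Finset.sum_congr rfl fun b' _ => ?_
    rw [integral_const_mul]
    rfl
  simp only [LinearMap.sub_apply, Matrix.mul_sub, Matrix.sub_mul, Matrix.sub_apply, hens,
    hhaar] at key
  have hfinal : ∑ i, E.weight i * ∏ s, ∑ j, c s j * ‖((V⁻¹ * E.unitary i).1 *ᵥ ψ) j‖ ^ 2 -
      ∫ U, ∏ s, ∑ j, c s j * ‖(U.1 *ᵥ ψ) j‖ ^ 2 ∂(haarUnitary α) =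
      ∑ a : Fin t → α, (∏ s, c s (a s)) *
        ((∑ i, E.weight i * ∏ s, ‖((V⁻¹ * E.unitary i).1 *ᵥ ψ) (a s)‖ ^ 2) -
        ∫ U, ∏ s, ‖(U.1 *ᵥ ψ) (a s)‖ ^ 2 ∂(haarUnitary α)) := by
    simp only [hfac, mul_sub, Finset.sum_sub_distrib]
    congr 1
    · simp only [Finset.mul_sum]
      rw [Finset.sum_comm]
      refine Finset.sum_congr rfl fun a _ => Finset.sum_congr rfl fun i _ => by ring
    · rw [integral_finsetSum _ fun a _ => integrable_haarUnitary_of_continuous (by fun_prop)]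
      simp only [integral_const_mul]
  rw [hfinal, ← Real.norm_eq_abs, ← Complex.norm_real]
  push_cast at key ⊢
  exact key

/-! ### Circuits are unitary and finite in number -/

/-- A matrix acting as a unitary on a coordinate `σ` within the classes of an equivalence relation
is unitary. -/
theorem fiberwise_mem_unitaryGroup {X S : Type*} [Fintype X] [DecidableEq X] [Fintype S]
    [DecidableEq S] (σ : X → S) (R : X → X → Prop) [DecidableRel R] (hR : Equivalence R)
    (τ : X → S → X) (hσ : ∀ x s, σ (τ x s) = s) (hτ : ∀ x s, R x (τ x s))
    (hinj : ∀ x y, R x y → σ x = σ y → x = y) (g : Matrix.unitaryGroup S ℂ) :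
    (Matrix.of fun x y => if R x y then g.1 (σ x) (σ y) else 0) ∈ Matrix.unitaryGroup X ℂ := by
  rw [Matrix.mem_unitaryGroup_iff]
  ext x z
  rw [Matrix.mul_apply, Matrix.one_apply]
  simp only [Matrix.star_apply, Matrix.of_apply]
  by_cases hxz : R x z
  · have h1 : ∀ y, (if R x y then g.1 (σ x) (σ y) else 0) *
        star (if R z y then g.1 (σ z) (σ y) else 0) =
        if R x y then g.1 (σ x) (σ y) * star (g.1 (σ z) (σ y)) else 0 := by
      intro y
      by_cases hxy : R x y
      · simp [hxy, hR.trans (hR.symm hxz) hxy]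
      · simp [hxy]
    simp only [h1]
    rw [← Finset.sum_filter]
    have h2 : ∑ y with R x y, g.1 (σ x) (σ y) * star (g.1 (σ z) (σ y)) =
        ∑ s, g.1 (σ x) s * star (g.1 (σ z) s) := by
      refine Finset.sum_bij' (fun y _ => σ y) (fun s _ => τ x s) ?_ ?_ ?_ ?_ ?_
      · simp
      · simp [hτ]
      · intro y hy
        have hy' : R x y := by simpa using hy
        exact hinj _ _ (hR.trans (hR.symm (hτ x _)) hy') (hσ _ _)
      · simp [hσ]
      · simp
    have h3 := congrFun (congrFun (Matrix.mem_unitaryGroup_iff.mp g.2) (σ x)) (σ z)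
    rw [Matrix.mul_apply, Matrix.one_apply] at h3
    rw [h2]
    refine h3.trans ?_
    by_cases h : x = z
    · simp [h]
    · have : σ x ≠ σ z := fun hs => h (hinj _ _ hxz hs)
      simp [h, this]
  · rw [if_neg (fun h : x = z => hxz (h ▸ hR.refl x))]
    refine Finset.sum_eq_zero fun y _ => ?_
    by_cases hxy : R x y
    · have : ¬ R z y := fun h => hxz (hR.trans hxy (hR.symm h))
      simp [this]
    · simp [hxy]

theorem quditGate_mem_unitaryGroup {n q : ℕ} {i j : Fin n} (hij : i ≠ j)
    (g : Matrix.unitaryGroup (Fin q × Fin q) ℂ) :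
    quditGate i j g.1 ∈ Matrix.unitaryGroup (WithAncilla n q) ℂ := by
  refine fiberwise_mem_unitaryGroup (fun x : WithAncilla n q => (x.1 i, x.1 j))
    (fun x y => x.2 = y.2 ∧ ∀ l, l ≠ i → l ≠ j → x.1 l = y.1 l) ⟨?_, ?_, ?_⟩
    (fun x s => (Function.update (Function.update x.1 i s.1) j s.2, x.2)) ?_ ?_ ?_ g
  · simp
  · exact fun h => ⟨h.1.symm, fun l hi hj => (h.2 l hi hj).symm⟩
  · exact fun h h' => ⟨h.1.trans h'.1, fun l hi hj => (h.2 l hi hj).trans (h'.2 l hi hj)⟩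
  · intro x s
    simp [hij]
  · intro x s
    refine ⟨rfl, fun l hi hj => ?_⟩
    simp [hi, hj]
  · intro x y h hs
    refine Prod.ext (funext fun l => ?_) h.1
    by_cases hi : l = i
    · subst hi; exact congrArg Prod.fst hs
    · by_cases hj : l = j
      · subst hj; exact congrArg Prod.snd hs
      · exact h.2 l hi hj

theorem ancillaGate_mem_unitaryGroup {n q : ℕ} (i : Fin n)
    (h : Matrix.unitaryGroup (Fin q × Fin 2) ℂ) :
    ancillaGate i h.1 ∈ Matrix.unitaryGroup (WithAncilla n q) ℂ := by
  refine fiberwise_mem_unitaryGroup (fun x : WithAncilla n q => (x.1 i, x.2))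
    (fun x y => ∀ l, l ≠ i → x.1 l = y.1 l) ⟨?_, ?_, ?_⟩
    (fun x s => (Function.update x.1 i s.1, s.2)) ?_ ?_ ?_ h
  · simp
  · exact fun h l hi => (h l hi).symm
  · exact fun h h' l hi => (h l hi).trans (h' l hi)
  · intro x s
    simp
  · intro x s l hi
    simp [hi]
  · intro x y h hs
    refine Prod.ext (funext fun l => ?_) (Prod.ext_iff.mp hs).2
    by_cases hi : l = i
    · subst hi; exact congrArg Prod.fst hs
    · exact h l hi

theorem ancillaGate_one {n q : ℕ} (i : Fin n) :
    ancillaGate i (1 : Matrix (Fin q × Fin 2) (Fin q × Fin 2) ℂ) = 1 := by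
  ext x y
  have : x = y ↔ (∀ l, l ≠ i → x.1 l = y.1 l) ∧ (x.1 i, x.2) = (y.1 i, y.2) := by
    constructor
    · rintro rfl; simp
    · rintro ⟨h, hs⟩
      refine Prod.ext (funext fun l => ?_) (Prod.ext_iff.mp hs).2
      by_cases hi : l = i
      · subst hi; exact congrArg Prod.fst hs
      · exact h l hi
  simp only [ancillaGate, Matrix.of_apply, Matrix.one_apply, this, ite_and]

theorem mem_unitaryGroup_of_mem_circuits {n q : ℕ}
    {G : Finset (Matrix.unitaryGroup (Fin q × Fin q) ℂ)}
    {A : Finset (Matrix.unitaryGroup (Fin q × Fin 2) ℂ)} {r : ℕ}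
    {V : Matrix (WithAncilla n q) (WithAncilla n q) ℂ} (hV : V ∈ circuits G A r) :
    V ∈ Matrix.unitaryGroup (WithAncilla n q) ℂ := by
  obtain ⟨L, _, hL, rfl⟩ := hV
  refine list_prod_mem fun W hW => ?_
  rcases hL W hW with ⟨g, _, i, j, hij, rfl⟩ | ⟨h, _, i, _, rfl⟩
  · refine quditGate_mem_unitaryGroup (fun h => ?_) g
    rw [h] at hij
    omega
  · exact ancillaGate_mem_unitaryGroup i h

theorem exists_finset_isElementary {n q : ℕ}
    (G : Finset (Matrix.unitaryGroup (Fin q × Fin q) ℂ))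
    (A : Finset (Matrix.unitaryGroup (Fin q × Fin 2) ℂ)) (hAG : A.card ≤ G.card) :
    ∃ S : Finset (Matrix (WithAncilla n q) (WithAncilla n q) ℂ),
      (∀ W, IsElementary G A W → W ∈ S) ∧ S.card ≤ n * G.card := by
  classical
  -- There are `n` bonds, indexed by their left qudit: `n - 1` between qudits and the last one to
  -- the ancilla. Each contributes at most `|G|` matrices.
  refine ⟨Finset.univ.biUnion fun i : Fin n => if h : (i : ℕ) + 1 < n then
    G.image fun g => quditGate i ⟨i + 1, h⟩ g.1 else A.image fun h => ancillaGate i h.1, ?_, ?_⟩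
  · rintro W (⟨g, hg, i, j, hij, rfl⟩ | ⟨h, hh, i, hi, rfl⟩)
    · have hj : j = ⟨i + 1, hij ▸ j.2⟩ := Fin.ext hij
      refine Finset.mem_biUnion.mpr ⟨i, Finset.mem_univ _, ?_⟩
      rw [dif_pos (hij ▸ j.2 : (i : ℕ) + 1 < n)]
      exact Finset.mem_image.mpr ⟨g, hg, by rw [← hj]⟩
    · refine Finset.mem_biUnion.mpr ⟨i, Finset.mem_univ _, ?_⟩
      rw [dif_neg (by omega)]
      exact Finset.mem_image.mpr ⟨h, hh, rfl⟩
  · refine (Finset.card_biUnion_le_card_mul _ _ G.card fun i _ => ?_).trans (by simp)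
    split_ifs
    · exact Finset.card_image_le
    · exact Finset.card_image_le.trans hAG

theorem exists_finset_circuits {n q : ℕ}
    (G : Finset (Matrix.unitaryGroup (Fin q × Fin q) ℂ))
    (A : Finset (Matrix.unitaryGroup (Fin q × Fin 2) ℂ)) (hn : 1 ≤ n) (h1 : 1 ∈ A)
    (hAG : A.card ≤ G.card) (r : ℕ) :
    ∃ S : Finset (Matrix (WithAncilla n q) (WithAncilla n q) ℂ),
      (∀ V ∈ circuits G A r, V ∈ S) ∧ S.card ≤ (n * G.card) ^ r := by
  classical
  obtain ⟨S, hS, hcard⟩ := exists_finset_isElementary (n := n) G A hAG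
  have hone : (1 : Matrix (WithAncilla n q) (WithAncilla n q) ℂ) ∈ S :=
    hS _ (Or.inr ⟨1, h1, ⟨n - 1, by omega⟩, by simp; omega, (ancillaGate_one _).symm⟩)
  refine ⟨(Fintype.piFinset fun _ : Fin r => S).image fun f => (List.ofFn f).prod, ?_, ?_⟩
  · rintro V ⟨L, hlen, hL, rfl⟩
    -- Shorter circuits are padded with identities to length exactly `r`, so that lists of length
    -- `r` account for all of them.
    let L' := L ++ List.replicate (r - L.length) 1
    have hlen' : L'.length = r := by simp [L']; omega
    have hmem : ∀ W ∈ L', W ∈ S := by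
      intro W hW
      rcases List.mem_append.mp hW with hW | hW
      · exact hS W (hL W hW)
      · rw [List.eq_of_mem_replicate hW]; exact hone
    refine Finset.mem_image.mpr ⟨fun i => L'.get (i.cast hlen'.symm), ?_, ?_⟩
    · exact Fintype.mem_piFinset.mpr fun i => hmem _ (List.get_mem _ _)
    · have : List.ofFn (fun i : Fin r => L'.get (i.cast hlen'.symm)) = L' := by
        clear_value L'
        subst hlen'
        exact List.ofFn_get L'
      rw [this]
      simp [L']
  · refine Finset.card_image_le.trans ?_
    rw [Fintype.card_piFinset]
    simpa using Nat.pow_le_pow_left hcard r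

theorem exists_finset_simpleMeasurements {n q : ℕ}
    (G : Finset (Matrix.unitaryGroup (Fin q × Fin q) ℂ))
    (A : Finset (Matrix.unitaryGroup (Fin q × Fin 2) ℂ)) (hn : 1 ≤ n) (h1 : 1 ∈ A)
    (hAG : A.card ≤ G.card) (r : ℕ) :
    ∃ S : Finset (Matrix (Qudits n q) (Qudits n q) ℂ),
      (S : Set (Matrix (Qudits n q) (Qudits n q) ℂ)) = simpleMeasurements G A r ∧
        S.card ≤ 2 * q ^ n * (n * G.card) ^ r := by
  classical
  obtain ⟨S, hS, hcard⟩ := exists_finset_circuits (n := n) G A hn h1 hAG r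
  let F := (S ×ˢ Finset.Icc 1 (2 * q ^ n)).image fun p => partialTraceRight
      (((1 : Matrix (Qudits n q) (Qudits n q) ℂ) ⊗ₖ Matrix.single (0 : Fin 2) 0 (1 : ℂ)) *
        (p.1 * basisProj n q p.2 * p.1ᴴ))
  refine ⟨F.filter (· ∈ simpleMeasurements G A r), ?_, ?_⟩
  · ext M
    simp only [Finset.coe_filter, Set.mem_ofPred_eq, and_iff_right_iff_imp]
    rintro ⟨V, hV, l, hl1, hl2, rfl⟩
    exact Finset.mem_image.mpr ⟨(V, l), by simp [hS V hV, hl1, hl2], rfl⟩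
  · refine (Finset.card_filter_le _ _).trans (Finset.card_image_le.trans ?_)
    rw [Finset.card_product, Nat.card_Icc, mul_comm]
    simpa using Nat.mul_le_mul_left (2 * q ^ n) hcard

theorem simpleMeasurements_nonempty {n q : ℕ}
    (G : Finset (Matrix.unitaryGroup (Fin q × Fin q) ℂ))
    (A : Finset (Matrix.unitaryGroup (Fin q × Fin 2) ℂ)) (hq : 1 ≤ q) (r : ℕ) :
    (simpleMeasurements (n := n) G A r).Nonempty :=
  ⟨_, 1, ⟨[], by simp, by simp, rfl⟩, 1, le_rfl, by have := Nat.one_le_pow n q hq; omega, rfl⟩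

theorem simpleMeasurements_mono {n q : ℕ}
    (G : Finset (Matrix.unitaryGroup (Fin q × Fin q) ℂ))
    (A : Finset (Matrix.unitaryGroup (Fin q × Fin 2) ℂ)) {r r' : ℕ} (h : r' ≤ r) :
    simpleMeasurements (n := n) G A r' ⊆ simpleMeasurements G A r := by
  rintro M ⟨V, ⟨L, hlen, hL, hV⟩, l, hl⟩
  exact ⟨V, ⟨L, hlen.trans h, hL, hV⟩, l, hl⟩

/-! ### Simple measurements as effects -/

theorem partialTraceRight_kronecker_single_mul {α γ : Type*} [Fintype α] [DecidableEq α]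
    [Fintype γ] [DecidableEq γ] (c : γ) (W : Matrix (α × γ) (α × γ) ℂ) :
    partialTraceRight (((1 : Matrix α α ℂ) ⊗ₖ Matrix.single c c (1 : ℂ)) * W) =
      W.submatrix (fun a => (a, c)) (fun a => (a, c)) := by
  ext a b
  simp only [partialTraceRight, Matrix.of_apply, Matrix.mul_apply, Fintype.sum_prod_type,
    Matrix.kroneckerMap_apply, Matrix.one_apply, Matrix.single_apply, Matrix.submatrix_apply]
  simp [ite_and]

section
open scoped ComplexOrder

/-- Projecting the ancilla on `|0⟩` and tracing it out selects a diagonal block of the projector `V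
P_l Vᴴ`; a compression of a projector lies between `0` and `1`. -/
theorem posSemidef_of_mem_simpleMeasurements {n q : ℕ}
    {G : Finset (Matrix.unitaryGroup (Fin q × Fin q) ℂ)}
    {A : Finset (Matrix.unitaryGroup (Fin q × Fin 2) ℂ)} {r : ℕ}
    {M : Matrix (Qudits n q) (Qudits n q) ℂ} (hM : M ∈ simpleMeasurements G A r) :
    M.PosSemidef ∧ (1 - M).PosSemidef := by
  obtain ⟨V, hV, l, -, -, rfl⟩ := hM
  have hVV : V * Vᴴ = 1 := Matrix.mem_unitaryGroup_iff.mp (mem_unitaryGroup_of_mem_circuits hV)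
  rw [partialTraceRight_kronecker_single_mul]
  constructor
  · refine Matrix.PosSemidef.submatrix (Matrix.PosSemidef.mul_mul_conjTranspose_same ?_ V) _
    refine Matrix.PosSemidef.diagonal fun x => ?_
    dsimp only
    split_ifs <;> simp
  · have : (1 : Matrix (Qudits n q) (Qudits n q) ℂ) - (V * basisProj n q l * Vᴴ).submatrix
        (fun a => (a, 0)) (fun a => (a, 0)) =
        (V * (1 - basisProj n q l) * Vᴴ).submatrix (fun a => (a, 0)) (fun a => (a, 0)) := by
      rw [Matrix.mul_sub, Matrix.sub_mul, Matrix.mul_one, hVV, Matrix.submatrix_sub]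
      congr 1
      exact (Matrix.submatrix_one _ fun a b h => congrArg Prod.fst h).symm
    rw [this]
    refine Matrix.PosSemidef.submatrix (Matrix.PosSemidef.mul_mul_conjTranspose_same ?_ V) _
    rw [basisProj, ← Matrix.diagonal_one, Matrix.diagonal_sub]
    refine Matrix.PosSemidef.diagonal fun x => ?_
    dsimp only
    split_ifs <;> simp

/-- The bias of an effect `0 ≤ M ≤ 1` in its eigenbasis. -/
theorem exists_diag_of_effect {α : Type*} [Fintype α] [DecidableEq α] [Nonempty α]
    {M : Matrix α α ℂ} (h0 : M.PosSemidef) (h1 : (1 - M).PosSemidef) :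
    ∃ (V : Matrix.unitaryGroup α ℂ) (b : α → ℝ), (∀ j, |b j| ≤ 1) ∧ ∑ j, b j = 0 ∧
      ∀ φ : α → ℂ, ∑ j, ‖φ j‖ ^ 2 = 1 →
        (M * (Matrix.vecMulVec φ (star φ) - ((Fintype.card α : ℂ)⁻¹) • (1 : Matrix α α ℂ))).trace =
          ((∑ j, b j * ‖(V⁻¹.1 *ᵥ φ) j‖ ^ 2 : ℝ) : ℂ) := by
  set V := h0.isHermitian.eigenvectorUnitary
  set m := h0.isHermitian.eigenvalues
  set D : Matrix α α ℂ := Matrix.diagonal fun j => (m j : ℂ) with hD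
  have hV1 : V.1ᴴ * V.1 = 1 := Matrix.mem_unitaryGroup_iff'.mp V.2
  have hV2 : V.1 * V.1ᴴ = 1 := Matrix.mem_unitaryGroup_iff.mp V.2
  have hspec : M = V.1 * D * V.1ᴴ := by
    have := h0.isHermitian.spectral_theorem
    rwa [Unitary.conjStarAlgAut_apply] at this
  have hm0 : ∀ j, 0 ≤ m j := h0.eigenvalues_nonneg
  have hm1 : ∀ j, m j ≤ 1 := by
    have h2 : (V.1ᴴ * (1 - M) * V.1) = Matrix.diagonal fun j => ((1 - m j : ℝ) : ℂ) := by
      have h3 : V.1ᴴ * M * V.1 = D := by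
        calc V.1ᴴ * M * V.1 = (V.1ᴴ * V.1) * D * (V.1ᴴ * V.1) := by
              rw [hspec]; simp only [Matrix.mul_assoc]
          _ = D := by rw [hV1]; simp
      rw [Matrix.mul_sub, Matrix.sub_mul, Matrix.mul_one, hV1, h3, hD, ← Matrix.diagonal_one,
        Matrix.diagonal_sub]
      simp
    have h4 := h1.conjTranspose_mul_mul_same V.1
    rw [h2, Matrix.posSemidef_diagonal_iff] at h4
    intro j
    have := h4 j
    rw [Complex.zero_le_real] at this
    linarith
  set d : ℝ := (Fintype.card α : ℝ) with hd
  have hdpos : 0 < d := by rw [hd]; exact_mod_cast Fintype.card_pos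
  -- Subtracting `𝟙/d` from the state amounts to subtracting the mean eigenvalue, which is what
  -- makes the weights sum to zero.
  set μ : ℝ := (∑ j, m j) / d with hμ
  have hμ0 : 0 ≤ μ := div_nonneg (Finset.sum_nonneg fun j _ => hm0 j) hdpos.le
  have hμ1 : μ ≤ 1 := by
    rw [hμ, div_le_one hdpos]
    refine (Finset.sum_le_card_nsmul _ _ 1 fun j _ => hm1 j).trans ?_
    simp [hd]
  refine ⟨V, fun j => m j - μ, fun j => ?_, ?_, fun φ hφ => ?_⟩
  · rw [abs_le]
    constructor <;> linarith [hm0 j, hm1 j]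
  · rw [Finset.sum_sub_distrib]
    simp only [Finset.sum_const, Finset.card_univ, nsmul_eq_mul, ← hd, hμ]
    field_simp
    ring
  · have hV' : V⁻¹.1 = V.1ᴴ := rfl
    have ht1 : (M * Matrix.vecMulVec φ (star φ)).trace =
        ((∑ j, m j * ‖(V⁻¹.1 *ᵥ φ) j‖ ^ 2 : ℝ) : ℂ) := by
      have : (M * Matrix.vecMulVec φ (star φ)).trace =
          star (V⁻¹.1 *ᵥ φ) ⬝ᵥ (D *ᵥ (V⁻¹.1 *ᵥ φ)) := by
        rw [Matrix.mul_vecMulVec, Matrix.trace_vecMulVec, dotProduct_comm, Matrix.star_mulVec, hV',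
          Matrix.conjTranspose_conjTranspose, ← Matrix.dotProduct_mulVec, Matrix.mulVec_mulVec,
          Matrix.mulVec_mulVec, ← hspec]
      rw [this]
      simp only [dotProduct, hD, Matrix.mulVec_diagonal, Pi.star_apply]
      push_cast
      refine Finset.sum_congr rfl fun j _ => ?_
      rw [← Complex.mul_conj', ← Complex.star_def]
      ring
    have ht2 : M.trace = ((∑ j, m j : ℝ) : ℂ) := by
      rw [h0.isHermitian.trace_eq_sum_eigenvalues]
      push_cast
      rfl
    have hφ' := sum_norm_sq_unitary_mulVec V⁻¹ φ
    rw [Matrix.mul_sub, Matrix.trace_sub, ht1, Matrix.mul_smul, Matrix.mul_one, Matrix.trace_smul,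
      ht2]
    simp only [sub_mul, Finset.sum_sub_distrib, ← Finset.mul_sum, hφ', hφ, hμ]
    push_cast
    simp only [hd, smul_eq_mul, Complex.ofReal_natCast]
    ring

end

/-! ### Tail bounds for approximate designs -/

theorem homSum_single {α : Type*} [Fintype α] [DecidableEq α] (j₀ : α) (t : ℕ) :
    homSum (fun j => if j = j₀ then 1 else 0) t = 1 := by
  rw [← coeff_prod_geometric, Finset.prod_eq_single j₀]
  · simp
  · intro j _ hj
    ext n
    simp [hj, zero_pow_eq, PowerSeries.coeff_one]
  · simp

theorem factorial_two_mul_le (k : ℕ) : ((2 * k).factorial : ℝ) ≤ (4 * (k : ℝ) ^ 2) ^ k := by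
  have h : (2 * k).factorial ≤ (2 * k) ^ (2 * k) := Nat.factorial_le_pow _
  calc ((2 * k).factorial : ℝ) ≤ ((2 * k) ^ (2 * k) : ℕ) := by exact_mod_cast h
    _ = (4 * (k : ℝ) ^ 2) ^ k := by
      push_cast
      rw [pow_mul]
      congr 1
      ring

theorem pow_le_factorial_mul_choose (d t : ℕ) :
    (d : ℝ) ^ t ≤ t.factorial * ((d + t - 1).choose t : ℝ) := by
  have h := Nat.pow_le_choose (α := ℝ) t (d + t - 1)
  rcases Nat.eq_zero_or_pos t with rfl | ht
  · simp
  · rw [show d + t - 1 + 1 - t = d by omega] at h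
    rw [div_le_iff₀ (by positivity), mul_comm] at h
    exact_mod_cast h

section Tail

variable {α : Type*} [Fintype α] [DecidableEq α] [Nonempty α]

/-- The Haar moment is at most `d^k (2k)! / d^(2k)`, and `(2k)! ≤ (4k²)^k`. The design error `(2k)!
ε / d^(4k)` is at most `ε` times the same bound, whence the factor `1 + ε`. -/
theorem design_moment_le (E : UnitaryEnsemble α) {ε : ℝ} (hε : 0 ≤ ε) {k : ℕ}
    (hE : E.IsApproxDesign ε (2 * k)) (ψ : α → ℂ) (hψ : ∑ j, ‖ψ j‖ ^ 2 = 1)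
    (V : Matrix.unitaryGroup α ℂ) (b : α → ℝ) (hb : ∀ j, |b j| ≤ 1) (hsum : ∑ j, b j = 0) :
    ∑ i, E.weight i * (∑ j, b j * ‖((V⁻¹ * E.unitary i).1 *ᵥ ψ) j‖ ^ 2) ^ (2 * k) ≤
      (1 + ε) * (4 * (k : ℝ) ^ 2 / Fintype.card α) ^ k := by
  set d : ℝ := (Fintype.card α : ℝ) with hd
  have hd1 : 1 ≤ d := by rw [hd]; exact_mod_cast Fintype.card_pos
  have hd0 : 0 < d := by linarith
  have h1 := abs_design_sub_haar_le E hε hE ψ hψ V (fun _ => b) fun _ => hb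
  simp only [Finset.prod_const, Finset.card_univ, Fintype.card_fin] at h1
  rw [integral_observable_pow ψ hψ] at h1
  have h2 := (abs_le.mp h1).2
  have hfac := factorial_two_mul_le k
  have hhaar : homSum b (2 * k) / ((Fintype.card α + 2 * k - 1).choose (2 * k) : ℝ) ≤
      (4 * (k : ℝ) ^ 2 / d) ^ k := by
    have h3 := pow_le_factorial_mul_choose (Fintype.card α) (2 * k)
    have h4 := (le_abs_self _).trans (abs_homSum_le b hb hsum (2 * k))
    rw [Nat.mul_div_cancel_left _ two_pos] at h4
    rw [← hd] at h3 h4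
    have hpos : 0 < ((Fintype.card α + 2 * k - 1).choose (2 * k) : ℝ) := by
      by_contra hn
      have : 0 < d ^ (2 * k) := by positivity
      have h5 : (0 : ℝ) < (2 * k).factorial := by exact_mod_cast Nat.factorial_pos _
      nlinarith
    rw [div_le_iff₀ hpos, div_pow, div_mul_eq_mul_div, le_div_iff₀ (by positivity)]
    calc homSum b (2 * k) * d ^ k ≤ d ^ k * d ^ k := by gcongr
      _ = d ^ (2 * k) := by rw [← pow_add, two_mul]
      _ ≤ _ := h3
      _ ≤ _ := by gcongr
  have herr : ((2 * k).factorial : ℝ) / d ^ (2 * (2 * k)) * ε ≤ ε * (4 * (k : ℝ) ^ 2 / d) ^ k := by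
    rw [mul_comm, div_pow]
    gcongr
    omega
  linarith

/-- Markov's inequality for the `2k`-th power, in the eigenbasis of `M`. -/
theorem design_tail_le (E : UnitaryEnsemble α) {ε : ℝ} (hε : 0 ≤ ε) {k : ℕ}
    (hE : E.IsApproxDesign ε (2 * k)) (ψ : α → ℂ) (hψ : ∑ j, ‖ψ j‖ ^ 2 = 1)
    {M : Matrix α α ℂ} (hM : open scoped ComplexOrder in M.PosSemidef ∧ (1 - M).PosSemidef)
    {τ : ℝ} (hτ : 0 < τ) (p : Fin E.N → Prop) [DecidablePred p]
    (hp : ∀ i, p i → τ ≤ ‖(M * (ketbra (WithLp.toLp 2 ((E.unitary i).1 *ᵥ ψ)) -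
      ((Fintype.card α : ℂ)⁻¹) • (1 : Matrix α α ℂ))).trace‖) :
    ∑ i with p i, E.weight i ≤ (1 + ε) * (4 * (k : ℝ) ^ 2 / (Fintype.card α * τ ^ 2)) ^ k := by
  obtain ⟨V, b, hb, hsum, hV⟩ := exists_diag_of_effect hM.1 hM.2
  have h1 := design_moment_le E hε hE ψ hψ V b hb hsum
  have h2 : (∑ i with p i, E.weight i) * τ ^ (2 * k) ≤
      ∑ i, E.weight i * (∑ j, b j * ‖((V⁻¹ * E.unitary i).1 *ᵥ ψ) j‖ ^ 2) ^ (2 * k) := by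
    rw [Finset.sum_mul]
    refine (Finset.sum_le_sum fun i hi => ?_).trans
      (Finset.sum_le_univ_sum_of_nonneg fun i => mul_nonneg (E.weight_nonneg i) ?_)
    · refine mul_le_mul_of_nonneg_left ?_ (E.weight_nonneg i)
      have h3 := hp i (Finset.mem_filter.mp hi).2
      have h4 := hV ((E.unitary i).1 *ᵥ ψ) (by rw [sum_norm_sq_unitary_mulVec, hψ])
      rw [show ketbra (WithLp.toLp 2 ((E.unitary i).1 *ᵥ ψ)) =
        Matrix.vecMulVec ((E.unitary i).1 *ᵥ ψ) (star ((E.unitary i).1 *ᵥ ψ)) from rfl, h4,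
        Complex.norm_real, Real.norm_eq_abs, Matrix.mulVec_mulVec] at h3
      rw [← (even_two_mul k).pow_abs (∑ j, _)]
      exact pow_le_pow_left₀ hτ.le h3 _
    · exact (even_two_mul k).pow_nonneg _
  have h5 : (1 + ε) * (4 * (k : ℝ) ^ 2 / (Fintype.card α * τ ^ 2)) ^ k =
      (1 + ε) * (4 * (k : ℝ) ^ 2 / Fintype.card α) ^ k / τ ^ (2 * k) := by
    rw [← div_div, div_pow _ (τ ^ 2), pow_mul τ, ← mul_div_assoc]
  rw [h5, le_div_iff₀ (by positivity)]
  exact h2.trans h1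

/-- No single state carries more than `(1 + ε) / C(d+k-1, k)` of the weight of an orbit. -/
theorem design_weight_le (E : UnitaryEnsemble α) {ε : ℝ} (hε : 0 ≤ ε) {k : ℕ} (hk : 1 ≤ k)
    (hE : E.IsApproxDesign ε (2 * k)) (hd : 4 * k ^ 2 ≤ Fintype.card α)
    (ψ : α → ℂ) (hψ : ∑ j, ‖ψ j‖ ^ 2 = 1) (i₀ : Fin E.N) (p : Fin E.N → Prop) [DecidablePred p]
    (hp : ∀ i, p i → ketbra (WithLp.toLp 2 ((E.unitary i).1 *ᵥ ψ)) =
      ketbra (WithLp.toLp 2 ((E.unitary i₀).1 *ᵥ ψ))) :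
    ∑ i with p i, E.weight i ≤ (1 + ε) / ((Fintype.card α + k - 1).choose k : ℝ) := by
  obtain ⟨j₀⟩ := ‹Nonempty α›
  -- In the frame `V` the state of `i₀` is the basis vector `j₀`, so the fidelity with it is the
  -- squared modulus of one coordinate.
  obtain ⟨V, hV⟩ := exists_unitary_col ((E.unitary i₀).1 *ᵥ ψ)
    (by rw [sum_norm_sq_unitary_mulVec, hψ]) j₀
  have hsq : ∀ φ : α → ℂ, ((‖(V⁻¹.1 *ᵥ φ) j₀‖ ^ 2 : ℝ) : ℂ) =
      (V.1ᴴ * ketbra (WithLp.toLp 2 φ) * V.1) j₀ j₀ := by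
    intro φ
    have : V.1ᴴ * ketbra (WithLp.toLp 2 φ) * V.1 =
        Matrix.vecMulVec (V⁻¹.1 *ᵥ φ) (star (V⁻¹.1 *ᵥ φ)) := by
      rw [ketbra, Matrix.mul_vecMulVec, Matrix.vecMulVec_mul, Matrix.star_mulVec,
        show V⁻¹.1 = V.1ᴴ from rfl, Matrix.conjTranspose_conjTranspose]
    rw [this, Matrix.vecMulVec_apply, Pi.star_apply, Complex.star_def, Complex.mul_conj']
    push_cast
    rfl
  have hi₀ : (V⁻¹.1 *ᵥ ((E.unitary i₀).1 *ᵥ ψ)) j₀ = 1 := by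
    have h1 : (E.unitary i₀).1 *ᵥ ψ = V.1 *ᵥ Pi.single j₀ 1 := by
      ext j
      simp [hV]
    rw [h1, Matrix.mulVec_mulVec, show V⁻¹.1 = star V.1 from rfl,
      Matrix.UnitaryGroup.star_mul_self]
    simp
  have hfid : ∀ i, p i → ‖((V⁻¹ * E.unitary i).1 *ᵥ ψ) j₀‖ ^ 2 = 1 := by
    intro i hi
    have h1 := hsq ((E.unitary i).1 *ᵥ ψ)
    rw [hp i hi, ← hsq, hi₀, Matrix.mulVec_mulVec] at h1
    have h2 := Complex.ofReal_injective h1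
    rw [norm_one, one_pow] at h2
    exact h2
  -- Split the `2k` slots in halves: `k` carry the indicator of `j₀`, and the other `k` carry the
  -- constant `1`, contributing the norm of the state. The Haar value is then `1 / C(d+k-1, k)`.
  rw [two_mul] at hE
  have h1 := abs_design_sub_haar_le E hε hE ψ hψ V
    (Fin.append (fun (_ : Fin k) j => if j = j₀ then (1 : ℝ) else 0) fun (_ : Fin k) _ => 1) (by
      intro s j
      induction s using Fin.addCases
      · simp only [Fin.append_left]
        split_ifs <;> simp
      · rw [Fin.append_right]; simp)
  simp only [Fin.prod_univ_add, Fin.append_left, Fin.append_right, one_mul,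
    sum_norm_sq_unitary_mulVec, hψ, Finset.prod_const, Finset.card_univ, Fintype.card_fin, one_pow,
    mul_one] at h1
  rw [integral_observable_pow ψ hψ, homSum_single, ← two_mul] at h1
  have h2 := (abs_le.mp h1).2
  have h3 : ∑ i with p i, E.weight i ≤ ∑ i, E.weight i *
      (∑ j, (if j = j₀ then (1 : ℝ) else 0) * ‖((V⁻¹ * E.unitary i).1 *ᵥ ψ) j‖ ^ 2) ^ k := by
    simp only [ite_mul, one_mul, zero_mul, Finset.sum_ite_eq', Finset.mem_univ, if_true]
    refine le_trans (Finset.sum_le_sum fun i hi => ?_)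
      (Finset.sum_le_univ_sum_of_nonneg fun i => mul_nonneg (E.weight_nonneg i) (by positivity))
    rw [hfid i (Finset.mem_filter.mp hi).2, one_pow, mul_one]
  -- With `4k² ≤ d`, `(2k)! C(d+k-1, k) ≤ d^k (2d)^k ≤ d^(3k)`, so the design error is at most an
  -- `ε` fraction of the Haar value.
  have h4 : ((2 * k).factorial : ℝ) / (Fintype.card α : ℝ) ^ (2 * (2 * k)) * ε ≤
      ε / ((Fintype.card α + k - 1).choose k : ℝ) := by
    set d := Fintype.card α
    have hkd : k ≤ d := (Nat.le_self_pow two_ne_zero k).trans (le_trans (by omega) hd)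
    have hchoose : 0 < (d + k - 1).choose k := Nat.choose_pos (by omega)
    have hd0 : 0 < (d : ℝ) := by exact_mod_cast hk.trans hkd
    rw [mul_comm, div_eq_mul_one_div ε]
    refine mul_le_mul_of_nonneg_left ?_ hε
    rw [div_le_div_iff₀ (by positivity) (by exact_mod_cast hchoose), one_mul]
    have h5 : ((d + k - 1).choose k : ℝ) ≤ (2 * (d : ℝ)) ^ k := by
      have h6 : (d + k - 1).choose k ≤ (d + k - 1) ^ k := Nat.choose_le_pow _ _
      have h7 : (d + k - 1) ^ k ≤ (2 * d) ^ k := Nat.pow_le_pow_left (by omega) _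
      exact_mod_cast h6.trans h7
    have h8 : 4 * (k : ℝ) ^ 2 ≤ d := by exact_mod_cast hd
    have h9 : (4 : ℝ) ≤ d := by
      have : (1 : ℝ) ≤ (k : ℝ) := by exact_mod_cast hk
      nlinarith
    calc ((2 * k).factorial : ℝ) * ((d + k - 1).choose k : ℝ)
        ≤ (4 * (k : ℝ) ^ 2) ^ k * (2 * (d : ℝ)) ^ k := by
          gcongr
          exact factorial_two_mul_le k
      _ ≤ (d : ℝ) ^ k * ((d : ℝ) * d) ^ k := by
          gcongr
          linarith
      _ = (d : ℝ) ^ (3 * k) := by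
          rw [← mul_pow, ← pow_three, ← pow_mul]
      _ ≤ (d : ℝ) ^ (2 * (2 * k)) := pow_le_pow_right₀ (by linarith) (by omega)
  rw [add_div]
  linarith

end Tail

/-! ### Counting the states of high complexity -/

/-- The measurement set is finite and nonempty, so the supremum in `maxBias` is attained. The sets
grow with `r`, so excluding size `r` excludes every smaller size. -/
theorem succ_le_stateComplexity {n q : ℕ} (hn : 1 ≤ n) (hq : 1 ≤ q)
    {G : Finset (Matrix.unitaryGroup (Fin q × Fin q) ℂ)}
    {A : Finset (Matrix.unitaryGroup (Fin q × Fin 2) ℂ)} (h1 : 1 ∈ A) (hAG : A.card ≤ G.card)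
    {δ : ℝ} {r : ℕ} {ρ : Matrix (Qudits n q) (Qudits n q) ℂ}
    (h : ∀ M ∈ simpleMeasurements G A r, ‖(M * (ρ - ((q : ℂ) ^ n)⁻¹ •
      (1 : Matrix (Qudits n q) (Qudits n q) ℂ))).trace‖ < 1 - 1 / (q : ℝ) ^ n - δ) :
    (r : ℕ∞) + 1 ≤ stateComplexity G A δ ρ := by
  refine le_iInf₂ fun r' hr' => ?_
  by_contra hlt
  have hle : r' ≤ r := by
    by_contra hgt
    exact hlt (by exact_mod_cast not_le.mp hgt)
  obtain ⟨S, hS, -⟩ := exists_finset_simpleMeasurements (n := n) G A hn h1 hAG r'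
  have hmem := ((simpleMeasurements_nonempty (n := n) G A hq r').image (fun M =>
    ‖(M * (ρ - ((q : ℂ) ^ n)⁻¹ • (1 : Matrix (Qudits n q) (Qudits n q) ℂ))).trace‖)).csSup_mem
    ((hS ▸ S.finite_toSet).image _)
  obtain ⟨M, hM, hMeq⟩ := hmem
  have := h M (simpleMeasurements_mono G A hle hM)
  rw [maxBias, ← hMeq] at hr'
  exact absurd hr' (not_le.mpr this)

theorem stateBound_le_ncard (q n k r : ℕ) (ε δ : ℝ)
    (G : Finset (Matrix.unitaryGroup (Fin q × Fin q) ℂ))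
    (A : Finset (Matrix.unitaryGroup (Fin q × Fin 2) ℂ))
    (E : UnitaryEnsemble (Qudits n q)) (ψ₀ : EuclideanSpace ℂ (Qudits n q))
    (hq : 2 ≤ q) (hn : 1 ≤ n) (hk : 1 ≤ k) (hε : 0 < ε) (hδ : 0 < δ) (hδ1 : δ < 1)
    (hG : 1 ∈ G) (hA : 1 ∈ A) (hAG : A.card ≤ G.card) (hE : E.IsApproxDesign ε (2 * k))
    (hψ : ‖ψ₀‖ = 1) :
    stateBound q n k r G.card ε δ ≤
      ({ρ ∈ E.orbit ψ₀ | (r : ℕ∞) + 1 ≤ stateComplexity G A δ ρ}.ncard : ℝ) := by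
  classical
  set d : ℝ := (q : ℝ) ^ n with hd
  have hd1 : 1 ≤ d := one_le_pow₀ (by exact_mod_cast (by omega : 1 ≤ q))
  have hd0 : 0 < d := by linarith
  have hk1 : (1 : ℝ) ≤ k := by exact_mod_cast hk
  have hn1 : (1 : ℝ) ≤ n := by exact_mod_cast hn
  have hg1 : (1 : ℝ) ≤ G.card := by exact_mod_cast Finset.card_pos.mpr ⟨1, hG⟩
  have hδ' : 0 < 1 - δ := by linarith
  set B : ℝ := 16 * (k : ℝ) ^ 2 / (d * (1 - δ) ^ 2) with hB
  have hB0 : 0 < B := by positivity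
  set K : ℝ := ((q ^ n + k - 1).choose k : ℝ) with hK
  have hbound : stateBound q n k r G.card ε δ =
      K * (1 / (1 + ε) - 2 * d * (n : ℝ) ^ r * (G.card : ℝ) ^ r * B ^ k) := rfl
  rw [hbound]
  have hng : 1 ≤ (n : ℝ) ^ r * (G.card : ℝ) ^ r :=
    one_le_mul_of_one_le_of_one_le (one_le_pow₀ hn1) (one_le_pow₀ hg1)
  -- If `B ≥ 1` the bracket in `L` is nonpositive and nothing is claimed. Otherwise `d` is large
  -- enough for the estimates on `τ` and for `4k² ≤ d`.
  rcases le_or_gt (d * (1 - δ) ^ 2) (16 * (k : ℝ) ^ 2) with htriv | hmain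
  · refine le_trans (mul_nonpos_of_nonneg_of_nonpos (Nat.cast_nonneg _) ?_) (Nat.cast_nonneg _)
    have h1 : 1 ≤ B ^ k := one_le_pow₀ ((one_le_div (by positivity)).mpr htriv)
    have h2 : 1 / (1 + ε) ≤ 1 := by
      rw [div_le_one (by linarith)]; linarith
    have h3 : 1 ≤ d * ((n : ℝ) ^ r * (G.card : ℝ) ^ r) * B ^ k :=
      one_le_mul_of_one_le_of_one_le (one_le_mul_of_one_le_of_one_le hd1 hng) h1
    nlinarith
  have : Nonempty (Qudits n q) := ⟨fun _ => ⟨0, by omega⟩⟩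
  have hcard : Fintype.card (Qudits n q) = q ^ n := by simp
  have hcardR : (Fintype.card (Qudits n q) : ℝ) = d := by rw [hcard, hd]; push_cast; rfl
  have hcardC : (Fintype.card (Qudits n q) : ℂ) = (q : ℂ) ^ n := by rw [hcard]; push_cast; rfl
  have hψ' : ∑ j, ‖ψ₀.ofLp j‖ ^ 2 = 1 := by
    rw [← EuclideanSpace.norm_sq_eq, hψ, one_pow]
  have hdk : 16 * (k : ℝ) ^ 2 < d * (1 - δ) := by
    refine hmain.trans_le (mul_le_mul_of_nonneg_left ?_ hd0.le)
    nlinarith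
  set τ : ℝ := 1 - 1 / d - δ with hτ
  -- The term `1/d` costs at most half of `1 - δ`; squaring this factor `1/2` turns the `4k²` of the
  -- tail bound into the `16k²` of `B`.
  have hτ' : (1 - δ) / 2 ≤ τ := by
    have : 1 / d ≤ (1 - δ) / 2 := by
      rw [div_le_div_iff₀ hd0 two_pos]
      nlinarith
    rw [hτ]
    linarith
  have hτ0 : 0 < τ := by linarith
  have hdk' : 4 * k ^ 2 ≤ Fintype.card (Qudits n q) := by
    have h1 : 4 * (k : ℝ) ^ 2 ≤ d := by nlinarith
    rw [← hcardR] at h1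
    exact_mod_cast h1
  let ρ : Fin E.N → Matrix (Qudits n q) (Qudits n q) ℂ := fun i =>
    ketbra (WithLp.toLp 2 ((E.unitary i).1 *ᵥ ψ₀.ofLp))
  let X : Matrix (Qudits n q) (Qudits n q) ℂ → Fin E.N → ℝ := fun M i =>
    ‖(M * (ρ i - ((q : ℂ) ^ n)⁻¹ • (1 : Matrix (Qudits n q) (Qudits n q) ℂ))).trace‖
  obtain ⟨S, hS, hScard⟩ := exists_finset_simpleMeasurements (n := n) G A hn hA hAG r
  have hSmem : ∀ M, M ∈ S ↔ M ∈ simpleMeasurements G A r := fun M => by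
    rw [← hS, Finset.mem_coe]
  let H : Finset (Matrix (Qudits n q) (Qudits n q) ℂ) :=
    (Finset.univ.image ρ).filter fun σ => (r : ℕ∞) + 1 ≤ stateComplexity G A δ σ
  have hH : {ρ ∈ E.orbit ψ₀ | (r : ℕ∞) + 1 ≤ stateComplexity G A δ ρ} = (H : Set _) := by
    ext σ
    simp [H, UnitaryEnsemble.orbit, ρ]
  rw [hH, Set.ncard_coe_finset]
  have htail : ∀ M ∈ S, ∑ i with τ ≤ X M i, E.weight i ≤ (1 + ε) * B ^ k := by
    intro M hM
    refine (design_tail_le E hε.le hE ψ₀.ofLp hψ'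
      (posSemidef_of_mem_simpleMeasurements ((hSmem M).mp hM)) hτ0 _ fun i hi => ?_).trans ?_
    · rw [hcardC]
      exact hi
    · rw [hcardR]
      have : 4 * (k : ℝ) ^ 2 / (d * τ ^ 2) ≤ B := by
        have h1 : ((1 - δ) / 2) ^ 2 ≤ τ ^ 2 := pow_le_pow_left₀ (by linarith) hτ' 2
        rw [hB, div_le_div_iff₀ (by positivity) (by positivity)]
        nlinarith [mul_le_mul_of_nonneg_left h1 (show 0 ≤ 16 * (k : ℝ) ^ 2 * d by positivity)]
      gcongr
  have hweight : ∀ σ ∈ H, ∑ i with ρ i = σ, E.weight i ≤ (1 + ε) / K := by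
    intro σ hσ
    obtain ⟨i₀, -, rfl⟩ := Finset.mem_image.mp (Finset.mem_filter.mp hσ).1
    have := design_weight_le E hε.le hk hE hdk' ψ₀.ofLp hψ' i₀ (fun i => ρ i = ρ i₀) fun i hi => hi
    rwa [hcard] at this
  -- Every index either gives some simple measurement a bias of at least `τ` or produces a state in
  -- `H`.
  have hcover : (1 : ℝ) ≤ ∑ M ∈ S, ∑ i with τ ≤ X M i, E.weight i +
      ∑ σ ∈ H, ∑ i with ρ i = σ, E.weight i := by
    rw [← E.weight_sum]
    have hsub : (Finset.univ : Finset (Fin E.N)) ⊆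
        (S.biUnion fun M => Finset.univ.filter fun i => τ ≤ X M i) ∪
        (H.biUnion fun σ => Finset.univ.filter fun i => ρ i = σ) := by
      intro i _
      rw [Finset.mem_union]
      by_cases hi : ∃ M ∈ S, τ ≤ X M i
      · obtain ⟨M, hM, hMi⟩ := hi
        exact Or.inl (Finset.mem_biUnion.mpr ⟨M, hM, by simpa using hMi⟩)
      · refine Or.inr (Finset.mem_biUnion.mpr ⟨ρ i, ?_, by simp⟩)
        refine Finset.mem_filter.mpr ⟨Finset.mem_image_of_mem _ (Finset.mem_univ _), ?_⟩
        refine succ_le_stateComplexity hn (by omega) hA hAG fun M hM => ?_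
        by_contra hge
        exact hi ⟨M, (hSmem M).mpr hM, not_lt.mp hge⟩
    refine (Finset.sum_le_sum_of_subset_of_nonneg hsub fun i _ _ => E.weight_nonneg i).trans ?_
    have hunion : ∀ s t : Finset (Fin E.N), ∑ i ∈ s ∪ t, E.weight i ≤
        ∑ i ∈ s, E.weight i + ∑ i ∈ t, E.weight i := fun s t => by
      rw [← Finset.sum_union_inter]
      exact le_add_of_nonneg_right (Finset.sum_nonneg fun i _ => E.weight_nonneg i)
    have hbi : ∀ (T : Finset (Matrix (Qudits n q) (Qudits n q) ℂ)) (F : _ → Finset (Fin E.N)),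
        ∑ i ∈ T.biUnion F, E.weight i ≤ ∑ M ∈ T, ∑ i ∈ F M, E.weight i := fun T F => by
      induction T using Finset.induction_on with
      | empty => simp
      | insert a T ha ih =>
        rw [Finset.biUnion_insert, Finset.sum_insert ha]
        exact (hunion _ _).trans (by gcongr)
    exact (hunion _ _).trans (add_le_add (hbi _ _) (hbi _ _))
  have hT1 : ∑ M ∈ S, ∑ i with τ ≤ X M i, E.weight i ≤
      2 * d * ((n : ℝ) ^ r * (G.card : ℝ) ^ r) * ((1 + ε) * B ^ k) := by
    refine (Finset.sum_le_card_nsmul _ _ _ htail).trans ?_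
    rw [nsmul_eq_mul]
    have : (S.card : ℝ) ≤ 2 * d * ((n : ℝ) ^ r * (G.card : ℝ) ^ r) := by
      rw [← mul_pow, hd]
      exact_mod_cast hScard
    gcongr
  have hT2 : ∑ σ ∈ H, ∑ i with ρ i = σ, E.weight i ≤ H.card * ((1 + ε) / K) := by
    refine (Finset.sum_le_card_nsmul _ _ _ hweight).trans ?_
    rw [nsmul_eq_mul]
  have hK0 : 0 < K := by
    rw [hK]
    have : 1 ≤ q ^ n := Nat.one_le_pow _ _ (by omega)
    exact_mod_cast Nat.choose_pos (by omega)
  have hε1 : 0 < 1 + ε := by linarith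
  have hfin : (1 + ε) * (1 / (1 + ε) - 2 * d * (n : ℝ) ^ r * (G.card : ℝ) ^ r * B ^ k) ≤
      H.card * ((1 + ε) / K) := by
    have : (1 + ε) * (1 / (1 + ε)) = 1 := by field_simp
    rw [mul_sub, this]
    linarith
  have hfin' := mul_le_mul_of_nonneg_left hfin (div_nonneg hK0.le hε1.le)
  have e1 : K / (1 + ε) * (H.card * ((1 + ε) / K)) = H.card := by field_simp
  have e2 : ∀ x : ℝ, K / (1 + ε) * ((1 + ε) * x) = K * x := fun x => by field_simp
  rwa [e1, e2] at hfin'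

/-! ### Order of magnitude of the bound -/

theorem pow_div_le_choose (d k : ℕ) (hd : 1 ≤ d) :
    ((d : ℝ) / k) ^ k ≤ ((d + k - 1).choose k : ℝ) := by
  rcases Nat.eq_zero_or_pos k with rfl | hk
  · simp
  have h := Nat.pow_le_choose (α := ℝ) k (d + k - 1)
  rw [show d + k - 1 + 1 - k = d by omega] at h
  refine le_trans ?_ h
  rw [div_pow]
  have h1 : (k.factorial : ℝ) ≤ (k : ℝ) ^ k := by exact_mod_cast Nat.factorial_le_pow k
  have h2 : (0 : ℝ) < k.factorial := by exact_mod_cast Nat.factorial_pos k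
  gcongr

/-- Here `d + k - 1 ≤ 2d`, and `k^k / k! ≤ e^k` converts the factorial into a power of `k`. -/
theorem choose_le_pow_div_exp (d k : ℕ) (hk : 1 ≤ k) (hkd : k ≤ d) :
    ((d + k - 1).choose k : ℝ) ≤ (2 * Real.exp 1 * (d : ℝ) / k) ^ k := by
  refine (Nat.choose_le_pow_div k (d + k - 1)).trans ?_
  have hk0 : (0 : ℝ) < k := by exact_mod_cast hk
  have h1 := Real.pow_div_factorial_le_exp (x := (k : ℝ)) hk0.le k
  have h2 : (0 : ℝ) < k.factorial := by exact_mod_cast Nat.factorial_pos k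
  have h3 : Real.exp k = Real.exp 1 ^ k := by rw [← Real.exp_nat_mul, mul_one]
  have h4 : ((d + k - 1 : ℕ) : ℝ) ≤ 2 * d := by exact_mod_cast (by omega : d + k - 1 ≤ 2 * d)
  rw [h3, div_le_iff₀ h2] at h1
  rw [div_le_iff₀ h2, mul_right_comm, div_pow, mul_pow, div_mul_eq_mul_div,
    le_div_iff₀ (by positivity)]
  calc ((d + k - 1 : ℕ) : ℝ) ^ k * (k : ℝ) ^ k
      ≤ (2 * (d : ℝ)) ^ k * (Real.exp 1 ^ k * k.factorial) := by gcongr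
    _ = _ := by ring

/-- The failure probability in `stateBound` is small once `y = d / k²` is large. -/
theorem failure_le {d y a : ℝ} {k : ℕ} (hk : 2 ≤ k) (hy : 1 ≤ y) (ha : 1 ≤ a)
    (hd : d = y * (k : ℝ) ^ 2) {δ ε P : ℝ} (hδ : δ < 1) (hε : 0 < ε)
    (haδ : a = 16 / (1 - δ) ^ 2) (hya : 16 * a * (1 + ε) ≤ y ^ (1 / 4 : ℝ))
    (hP0 : 0 ≤ P) (hP : P ≤ y ^ ((k : ℝ) / 4)) :
    2 * d * P * (16 * (k : ℝ) ^ 2 / (d * (1 - δ) ^ 2)) ^ k ≤ 1 / (2 * (1 + ε)) := by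
  have hy0 : 0 < y := by linarith
  have hk0 : (0 : ℝ) < k := by exact_mod_cast (by omega : 0 < k)
  have hk2 : (2 : ℝ) ≤ k := by exact_mod_cast hk
  have hδ' : 0 < 1 - δ := by linarith
  set z : ℝ := y ^ (1 / 4 : ℝ) with hz
  have hz1 : 1 ≤ z := Real.one_le_rpow hy (by norm_num)
  have hz0 : 0 < z := by linarith
  have hzy : y = z ^ 4 := by
    rw [hz, ← Real.rpow_natCast, ← Real.rpow_mul hy0.le]
    norm_num
  have hPz : P ≤ z ^ k := by
    refine hP.trans_eq ?_
    rw [hz, ← Real.rpow_natCast, ← Real.rpow_mul hy0.le]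
    congr 1
    ring
  have hbase : 16 * (k : ℝ) ^ 2 / (d * (1 - δ) ^ 2) = a / z ^ 4 := by
    rw [hd, haδ, hzy]
    field_simp
  have hkk : (k : ℝ) ^ 2 ≤ 4 ^ k := by
    have h1 : (k : ℝ) ≤ 2 ^ k := by exact_mod_cast (Nat.lt_two_pow_self (n := k)).le
    calc (k : ℝ) ^ 2 ≤ (2 ^ k) ^ 2 := by gcongr
      _ = 4 ^ k := by rw [← pow_mul, mul_comm, pow_mul]; norm_num
  -- This is where `k ≥ 2` enters. The prefactor `d = z^4 k²` costs at most `z^(2k) 4^k` and `P` at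
  -- most `z^k`; against `z^(-4k)` one power `z^(-k)` survives.
  have hz4 : z ^ 4 ≤ z ^ (2 * k) := pow_le_pow_right₀ hz1 (by omega)
  have hx : 4 * a / z ≤ 1 / (4 * (1 + ε)) := by
    rw [div_le_div_iff₀ hz0 (by linarith)]
    linarith
  have hx1 : 1 / (4 * (1 + ε)) ≤ 1 := by
    rw [div_le_one (by linarith)]
    linarith
  have hx0 : 0 ≤ 4 * a / z := by positivity
  rw [hbase, hd, hzy]
  calc 2 * (z ^ 4 * (k : ℝ) ^ 2) * P * (a / z ^ 4) ^ k
      ≤ 2 * (z ^ (2 * k) * 4 ^ k) * z ^ k * (a / z ^ 4) ^ k := by gcongr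
    _ = 2 * (4 * a / z) ^ k := by
      rw [div_pow, div_pow, mul_pow, ← pow_mul]
      field_simp
      ring
    _ ≤ 2 * (4 * a / z) := by
      gcongr
      exact pow_le_of_le_one hx0 (hx.trans hx1) (by omega)
    _ ≤ 2 * (1 / (4 * (1 + ε))) := by gcongr
    _ = 1 / (2 * (1 + ε)) := by field_simp; norm_num

theorem stateBound_order :
    ∃ c C : ℝ, 0 < c ∧ 0 < C ∧ ∀ ε δ : ℝ, 0 < ε → 0 < δ → δ < 1 →
      ∃ T : ℝ, ∀ q n k r g : ℕ, 2 ≤ q → 2 ≤ k → 1 ≤ g → g ≤ n →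
        T ≤ (n : ℝ) - 2 * Real.logb q k →
        (r : ℝ) ≤ c * ((k : ℝ) * ((n : ℝ) - 2 * Real.logb q k) / Real.logb q n) →
        1 / (2 * (1 + ε)) * ((q : ℝ) ^ n / k) ^ k ≤ stateBound q n k r g ε δ ∧
          stateBound q n k r g ε δ ≤ (C * (q : ℝ) ^ n / k) ^ k := by
  -- With `g ≤ n` the count is at most `n^(2r) = q^(2 r log_q n)`, and `c = 1/8` makes this at most
  -- `y^(k/4)`. The constant `2e` is that of `choose_le_pow_div_exp`.
  refine ⟨1 / 8, 2 * Real.exp 1, by norm_num, by positivity, fun ε δ hε hδ hδ1 => ?_⟩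
  have hδ' : 0 < 1 - δ := by linarith
  set a : ℝ := 16 / (1 - δ) ^ 2 with ha
  have ha1 : 1 ≤ a := by
    rw [ha, one_le_div (by positivity)]
    nlinarith
  set Y : ℝ := (16 * a * (1 + ε)) ^ 4 with hY
  have hb1 : 1 ≤ 16 * a * (1 + ε) := by nlinarith
  have hY1 : 1 ≤ Y := one_le_pow₀ hb1
  -- Since `q ≥ 2`, a base-two logarithm serves all `q` at once: `y = q^s ≥ 2^s ≥ Y`, which is the
  -- size required by `failure_le`.
  refine ⟨Real.logb 2 Y, fun q n k r g hq hk hg hgn hT hr => ?_⟩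
  have hq1 : (1 : ℝ) < q := by exact_mod_cast (by omega : 1 < q)
  have hq2 : (2 : ℝ) ≤ q := by exact_mod_cast hq
  have hq0 : (0 : ℝ) < q := by linarith
  have hk0 : (0 : ℝ) < k := by exact_mod_cast (by omega : 0 < k)
  have hn1 : (1 : ℝ) ≤ n := by exact_mod_cast hg.trans hgn
  have hn0 : (0 : ℝ) < n := by linarith
  set s : ℝ := (n : ℝ) - 2 * Real.logb q k with hs
  set y : ℝ := (q : ℝ) ^ s with hy
  have hT0 : 0 ≤ Real.logb 2 Y := Real.logb_nonneg (by norm_num) hY1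
  have hs0 : 0 ≤ s := hT0.trans hT
  have hYy : Y ≤ y := by
    calc Y = (2 : ℝ) ^ Real.logb 2 Y := (Real.rpow_logb (by norm_num) (by norm_num) (by linarith)).symm
      _ ≤ (2 : ℝ) ^ s := Real.rpow_le_rpow_of_exponent_le (by norm_num) hT
      _ ≤ y := Real.rpow_le_rpow (by norm_num) hq2 hs0
  have hy1 : 1 ≤ y := hY1.trans hYy
  have hy0 : 0 < y := by linarith
  have hd : (q : ℝ) ^ n = y * (k : ℝ) ^ 2 := by
    have h1 : (k : ℝ) = (q : ℝ) ^ Real.logb q k := (Real.rpow_logb hq0 hq1.ne' hk0).symm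
    have h2 : (k : ℝ) ^ 2 = (q : ℝ) ^ (2 * Real.logb q k) := by
      rw [mul_comm, Real.rpow_mul hq0.le, ← h1]
      norm_cast
    rw [h2, hy, ← Real.rpow_add hq0, hs, ← Real.rpow_natCast]
    congr 1
    ring
  have hkd : k ≤ q ^ n := by
    have h1 : (1 : ℝ) ≤ k := by exact_mod_cast (by omega : 1 ≤ k)
    have : (k : ℝ) ≤ (q : ℝ) ^ n := by
      rw [hd]
      nlinarith
    exact_mod_cast this
  have hP : (n : ℝ) ^ r * (g : ℝ) ^ r ≤ y ^ ((k : ℝ) / 4) := by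
    have hgn' : (g : ℝ) ≤ n := by exact_mod_cast hgn
    have h1 : (n : ℝ) ^ r * (g : ℝ) ^ r ≤ (n : ℝ) ^ (2 * (r : ℝ)) := by
      calc (n : ℝ) ^ r * (g : ℝ) ^ r ≤ (n : ℝ) ^ r * (n : ℝ) ^ r := by gcongr
        _ = (n : ℝ) ^ (2 * (r : ℝ)) := by
          rw [← pow_add, ← two_mul, ← Real.rpow_natCast]
          push_cast
          rfl
    have hlog0 : 0 ≤ Real.logb q n := Real.logb_nonneg hq1 hn1
    have h2 : 2 * (r : ℝ) * Real.logb q n ≤ s * ((k : ℝ) / 4) := by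
      -- When `log_q n = 0` the quotient bounding `r` is a division by zero; the desired inequality
      -- then holds without it.
      rcases hlog0.eq_or_lt with h0 | hpos
      · rw [← h0, mul_zero]
        positivity
      · have h3 := mul_le_mul_of_nonneg_right hr hpos.le
        rw [mul_assoc, div_mul_cancel₀ _ hpos.ne'] at h3
        linarith
    refine h1.trans ?_
    calc (n : ℝ) ^ (2 * (r : ℝ)) = ((q : ℝ) ^ Real.logb q n) ^ (2 * (r : ℝ)) := by
          rw [Real.rpow_logb hq0 hq1.ne' hn0]
      _ = (q : ℝ) ^ (2 * (r : ℝ) * Real.logb q n) := by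
          rw [← Real.rpow_mul hq0.le]
          congr 1
          ring
      _ ≤ (q : ℝ) ^ (s * ((k : ℝ) / 4)) := Real.rpow_le_rpow_of_exponent_le hq1.le h2
      _ = y ^ ((k : ℝ) / 4) := by rw [hy, Real.rpow_mul hq0.le]
  have hfail := failure_le hk hy1 ha1 hd hδ1 hε ha (by
    calc 16 * a * (1 + ε) = Y ^ (1 / 4 : ℝ) := by
          rw [hY, ← Real.rpow_natCast, ← Real.rpow_mul (by linarith)]
          norm_num
      _ ≤ y ^ (1 / 4 : ℝ) := Real.rpow_le_rpow (by linarith) hYy (by norm_num))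
    (by positivity) hP
  have hbound : stateBound q n k r g ε δ = ((q ^ n + k - 1).choose k : ℝ) *
      (1 / (1 + ε) - 2 * (q : ℝ) ^ n * ((n : ℝ) ^ r * (g : ℝ) ^ r) *
        (16 * (k : ℝ) ^ 2 / ((q : ℝ) ^ n * (1 - δ) ^ 2)) ^ k) := by
    rw [stateBound, mul_assoc _ ((n : ℝ) ^ r)]
  have hnonneg : 0 ≤ 2 * (q : ℝ) ^ n * ((n : ℝ) ^ r * (g : ℝ) ^ r) *
        (16 * (k : ℝ) ^ 2 / ((q : ℝ) ^ n * (1 - δ) ^ 2)) ^ k := by positivity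
  have hhalf : 1 / (1 + ε) = 1 / (2 * (1 + ε)) + 1 / (2 * (1 + ε)) := by
    field_simp
    norm_num
  have hone : 1 / (1 + ε) ≤ 1 := by
    rw [div_le_one (by linarith)]
    linarith
  have hlow := pow_div_le_choose (q ^ n) k (by omega)
  have hup := choose_le_pow_div_exp (q ^ n) k (by omega) hkd
  push_cast at hlow hup
  have hε' : 0 < 1 / (2 * (1 + ε)) := by positivity
  rw [hbound]
  constructor
  · rw [mul_comm]
    exact mul_le_mul hlow (by linarith) hε'.le (Nat.cast_nonneg _)
  · refine le_trans ?_ hup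
    exact mul_le_of_le_one_right (Nat.cast_nonneg _) (by linarith)

end DesignComplexity

theorem mainTheorem4 :
    -- the quantitative bound
    (∀ (q n k r : ℕ) (ε δ : ℝ)
      (G : Finset (Matrix.unitaryGroup (Fin q × Fin q) ℂ))
      (A : Finset (Matrix.unitaryGroup (Fin q × Fin 2) ℂ))
      (E : UnitaryEnsemble (Qudits n q)) (ψ₀ : EuclideanSpace ℂ (Qudits n q)),
      2 ≤ q → 1 ≤ n → 1 ≤ k → 0 < ε → 0 < δ → δ < 1 →
      1 ∈ G → 1 ∈ A → A.card ≤ G.card →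
      E.IsApproxDesign ε (2 * k) → ‖ψ₀‖ = 1 →
      stateBound q n k r G.card ε δ ≤
        ({ρ ∈ E.orbit ψ₀ | (r : ℕ∞) + 1 ≤ stateComplexity G A δ ρ}.ncard : ℝ)) ∧
    -- its order of magnitude
    (∃ c C : ℝ, 0 < c ∧ 0 < C ∧ ∀ ε δ : ℝ, 0 < ε → 0 < δ → δ < 1 →
      ∃ T : ℝ, ∀ q n k r g : ℕ, 2 ≤ q → 2 ≤ k → 1 ≤ g → g ≤ n →
        T ≤ (n : ℝ) - 2 * Real.logb q k →
        (r : ℝ) ≤ c * ((k : ℝ) * ((n : ℝ) - 2 * Real.logb q k) / Real.logb q n) →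
        1 / (2 * (1 + ε)) * ((q : ℝ) ^ n / k) ^ k ≤ stateBound q n k r g ε δ ∧
          stateBound q n k r g ε δ ≤ (C * (q : ℝ) ^ n / k) ^ k) := by
  refine ⟨?_, stateBound_order⟩
  intro q n k r ε δ G A E ψ₀
  exact stateBound_le_ncard q n k r ε δ G A E ψ₀
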